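/- **Setting.** For every $n\ge 2$ let $p=p_n\ge 1$, let $(Z_i,\mathbf X_i)$, $i\le n$, be i.i.d. copies of a random vector $(Z,\mathbf X)\in\mathbb R\times\mathbb R^{p}$ (whose law may depend on $n$), let $\beta\in\mathbb R^p$, and let $\hat\beta$ be any random vector in $\mathbb R^p$ (arbitrarily dependent on the sample) with $\mathbb P(\|\hat\beta-\beta\|_1>a_n)\le q_n$, where $a_n\ge 0$, $q_n\in[0,1]$, $a_n,q_n\to0$. Let $h=h_n>0$. Let $W=\beta'\mathbf X$ have Lebesgue density $f_\beta$, let $m_\beta(w)=\mathbb E(Z\mid W=w)$, and for $x$ in the support $\mathcal X$ of $\mathbf X$ put $f(\beta,x)=f_\beta(\beta'x)$, $m(\beta,x)=m_\beta(\beta'x)$. Define $$\hat l(\hat\beta,x)=\frac1{nh}\sum_{i=1}^n Z_iK\Big(\frac{\hat\beta'\mathbf X_i-\hat\beta'x}{h}\Big),\quad \hat f(\hat\beta,x)=\frac1{nh}\sum_{i=1}^n K\Big(\frac{\hat\beta'\mathbf X_i-\hat\beta'x}{h}\Big),\quad \hat m=\hat l/\hat f .$$ **Assumptions**, with constants $\sigma_Z,M_K,C_K,R_K,M_{K'},C_{K'},L,M_\varphi,C_\varphi,B_1,B_2,B_1^*,B_2^*,M_{\mathbf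 X}$ not depending on $n$: * Kernel: $|K|\le M_K$, $\int|K|\le C_K$, $\int K=1$, $\int uK(u)\,du=0$, $\int u^2|K(u)|\,du\le R_K$; $K$ is $C^1$ with $|K'|\le M_{K'}$, $\int|K'|\le C_{K'}$, and $K(u)\to0$ as $u\to\pm\infty$; $L>0$ and there is an integrable $\varphi\ge 0$ with $\varphi\le M_\varphi$, $\int\varphi\le C_\varphi$ and $|K'(u)-K'(v)|\le\varphi(u)|u-v|$ whenever $|u-v|\le L$. * $Z$ is sub-Gaussian: $\inf\{c>0:\mathbb E\,e^{(|Z|/c)^2}-1\le1\}\le\sigma_Z$. $\|\mathbf X\|_\infty\le M_{\mathbf X}$ a.s. * For $Y=Z$ and also for the constant response $Y\equiv1$: $\mathbb E(Y^2\mid W=w)f_\beta(w)$ is bounded by $B_1$; $l(w)=\mathbb E(Y\mid W=w)f_\beta(w)$ is $C^2$ with $|l''|\le B_2$ and $|l'|\le B_2^*$; and for each $j$, $\eta_j(w)=\mathbb E(Y\mathbf X_{[j]}\mid W=w)f_\beta(w)$ is $C^1$ with $|\eta_j'|\le B_1^*$. * Rates: $2M_{\mathbf X}a_n/h\le L$ and,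 with $b_n=h^2+a_n+a_n^2/h^2+\log(np)/(nh)$, each of $h$, $a_n/h$, $\log(np)/(nh)$, $(a_n/h)\sqrt{\log p}$, $b_n$ is $o(1)$. **Theorem.** Let $\kappa$ be a real number. There are constants $C_1,C_2,C_3>0$, depending only on $\kappa$ and the constants in the assumptions, such that with $$\epsilon_n(t)=C_1\frac{t+1}{\sqrt{nh}}+C_2\frac{t^2\sqrt{\log n}}{nh}+C_3b_n$$ the following holds for every $n\ge2$ with $(a_n/h)\sqrt{\log p}\le\kappa$ (thus for all large $n$ if $\kappa>0$ is fixed, and for all $n\ge 2$ if $\kappa$ is large enough) and every $x\in\mathcal X$. 1. For all $t\ge0$, each of $|\hat l(\hat\beta,x)-m(\beta,x)f(\beta,x)|\le\epsilon_n(t)$ and $|\hat f(\hat\beta,x)-f(\beta,x)|\le\epsilon_n(t)$ holds with probability at least $1-9e^{-t^2}-2q_n$. 2. Let $\delta_m,\delta_f>0$, $|m(\beta,x)|\le\delta_m$ and $f(\beta,x)\ge\delta_f$. For all $t,t_*\ge0$ with $\epsilon_n(t_*)\le\delta_f/2$, with probability at least $1-18e^{-t^2}-9e^{-t_*^2}-6q_n$,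 $$\hat f(\hat\beta,x)\ne0\quad\text{and}\quad|\hat m(\hat\beta,x)-m(\beta,x)|\le\frac{2(1+\delta_m)}{\delta_f}\,\epsilon_n(t).$$ Moreover there is a constant $D>0$, depending only on $\kappa,\delta_m,\delta_f$ and the constants in the assumptions, such that for all $t\ge0$ the right-hand side is at most $D\big(\frac{t+1}{\sqrt{nh}}+\frac{t^2\sqrt{\log n}}{nh}+b_n\big)$. 3. Assume in addition $\log(np)\log n/(nh)=o(1)$, and let $c>0$ be such that $\epsilon_n(c\sqrt{\log(np)})\le\delta_f/2$. Then in the situation of 2, with the same $D$, with probability at least $1-27(np)^{-c^2}-6q_n$, $\hat f(\hat\beta,x)\ne0$ and $$|\hat m(\hat\beta,x)-m(\beta,x)|\le D\Big[(c+1)\sqrt{\tfrac{\log(np)}{nh}}\Big(1+c\sqrt{\tfrac{\log(np)\log n}{nh}}\Big)+b_n\Big];$$ and, if also $c\sqrt{\log(np)\log n/(nh)}\le\kappa$ (true for all large $n$ if $\kappa>0$), with probability at least $1-27(np)^{-c^2}-6q_n$, $\hat f(\hat\beta,x)\ne0$ and $$|\hat m(\hat\beta,x)-m(\beta,x)|\le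 D\Big[c\sqrt{\tfrac{\log(np)}{nh}}+b_n\Big].$$ Finally, for each $t_*\ge0$ the condition $\epsilon_n(t_*)\le\delta_f/2$ holds for all large $n$; and if $\log(np)\log n/(nh)=o(1)$, then for each $c>0$ so does $\epsilon_n(c\sqrt{\log(np)})\le\delta_f/2$. -/

import Mathlib

open MeasureTheory ProbabilityTheory Filter Topology
open scoped ENNReal

noncomputable section

namespace SingleIndexKS

/-- The numerical constants that appear in the assumptions on the kernel and on the population. -/
structure Constants where
  /-- bound for the sub-Gaussian norm of the response -/
  sigmaZ : ℝ
  /-- sup bound for the kernel -/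
  MK : ℝ
  /-- bound for the integral of `|K|` -/
  CK : ℝ
  /-- bound for the integral of `u ^ 2 * |K u|` -/
  RK : ℝ
  /-- sup bound for the derivative of the kernel -/
  MdK : ℝ
  /-- bound for the integral of the absolute derivative of the kernel -/
  CdK : ℝ
  /-- radius of the local Lipschitz property of the derivative of the kernel -/
  L : ℝ
  /-- sup bound for the local Lipschitz function -/
  Mphi : ℝ
  /-- bound for the integral of the local Lipschitz function -/
  Cphi : ℝ
  /-- sup bound for (conditional second moment) times (index density) -/
  B1 : ℝ
  /-- sup bound for the second derivative of (regression function) times (index density) -/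
  B2 : ℝ
  /-- sup bound for the derivatives of the weighted conditional means of response times covariate -/
  B1star : ℝ
  /-- sup bound for the first derivative of (regression function) times (index density) -/
  B2star : ℝ
  /-- sup bound for the covariates -/
  MX : ℝ

/-- The `ψ₂`-Orlicz norm `inf {c > 0 : E [exp ((|Y| / c) ^ 2) - 1] ≤ 1}` (`∞` if there is no such
`c`). -/
def psiTwoNorm {Ω : Type*} [MeasurableSpace Ω] (μ : Measure Ω) (Y : Ω → ℝ) : ℝ≥0∞ :=
  ⨅ (c : ℝ) (_ : 0 < c)
    (_ : ∫⁻ ω, ENNReal.ofReal (Real.exp ((|Y ω| / c) ^ 2) - 1) ∂μ ≤ 1), ENNReal.ofReal c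

/-- `f` is a Lebesgue density of the real random variable `W`. -/
structure IsDensityOf {Ω : Type*} [MeasurableSpace Ω] (μ : Measure Ω) (W : Ω → ℝ)
    (f : ℝ → ℝ) : Prop where
  measurable : Measurable f
  nonneg : ∀ w, 0 ≤ f w
  map_eq : μ.map W = volume.withDensity (fun w => ENNReal.ofReal (f w))

/-- `g` is a version of the regression function `w ↦ E (Y | W = w)`. -/
structure IsRegressionFunction {Ω : Type*} [MeasurableSpace Ω] (μ : Measure Ω) (Y W : Ω → ℝ)
    (g : ℝ → ℝ) : Prop where
  integrable : Integrable Y μ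
  measurable : Measurable g
  condExp_eq : μ[Y | MeasurableSpace.comap W inferInstance] =ᵐ[μ] fun ω => g (W ω)

/-- The conditions on the kernel. -/
structure KernelConditions (A : Constants) (K : ℝ → ℝ) : Prop where
  bounded : ∀ u, |K u| ≤ A.MK
  integrable : Integrable K
  integral_abs_le : ∫ u, |K u| ≤ A.CK
  integral_eq_one : ∫ u, K u = 1
  integral_mul_eq_zero : ∫ u, u * K u = 0
  integrable_sq : Integrable (fun u => u ^ 2 * |K u|)
  integral_sq_le : ∫ u, u ^ 2 * |K u| ≤ A.RK
  contDiff : ContDiff ℝ 1 K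
  deriv_bounded : ∀ u, |deriv K u| ≤ A.MdK
  deriv_integrable : Integrable (deriv K)
  integral_abs_deriv_le : ∫ u, |deriv K u| ≤ A.CdK
  tendsto_atTop : Tendsto K atTop (𝓝 0)
  tendsto_atBot : Tendsto K atBot (𝓝 0)
  L_pos : 0 < A.L
  local_lipschitz : ∃ φ : ℝ → ℝ, (∀ u, 0 ≤ φ u) ∧ (∀ u, φ u ≤ A.Mphi) ∧ Integrable φ ∧
    ∫ u, φ u ≤ A.Cphi ∧
    ∀ u v, |u - v| ≤ A.L → |deriv K u - deriv K v| ≤ φ u * |u - v|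

/-- The smoothness and boundedness conditions on a response `Y` whose regression function on the
index `W = β' X` is `g`, where `f` is the density of `W`. -/
structure ResponseConditions (A : Constants) {p : ℕ} {Ω : Type*} [MeasurableSpace Ω]
    (μ : Measure Ω) (Y : Ω → ℝ) (X : Ω → Fin p → ℝ) (β : Fin p → ℝ) (f g : ℝ → ℝ) : Prop where
  regression : IsRegressionFunction μ Y (fun ω => β ⬝ᵥ X ω) g
  second_moment : ∃ g₂ : ℝ → ℝ,
    IsRegressionFunction μ (fun ω => Y ω ^ 2) (fun ω => β ⬝ᵥ X ω) g₂ ∧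
    ∀ w, |g₂ w * f w| ≤ A.B1
  contDiff : ContDiff ℝ 2 (fun w => g w * f w)
  deriv_two_bounded : ∀ w, |iteratedDeriv 2 (fun w => g w * f w) w| ≤ A.B2
  deriv_bounded : ∀ w, |deriv (fun w => g w * f w) w| ≤ A.B2star
  weighted : ∀ j : Fin p, ∃ r : ℝ → ℝ,
    IsRegressionFunction μ (fun ω => Y ω * X ω j) (fun ω => β ⬝ᵥ X ω) r ∧
    ContDiff ℝ 1 (fun w => r w * f w) ∧
    ∀ w, |deriv (fun w => r w * f w) w| ≤ A.B1star

/-- The conditions on the law `P` of the generic pair `(Z, X)`: here `f` is the density of the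
index `W = β' X` and `m` is the regression function of `Z` on `W`. The response conditions are
required of `Z` and of the constant response `1`, which is the one behind the density estimator. -/
structure PopulationConditions (A : Constants) {p : ℕ} (P : Measure (ℝ × (Fin p → ℝ)))
    (β : Fin p → ℝ) (f m : ℝ → ℝ) : Prop where
  subGaussian : psiTwoNorm P Prod.fst ≤ ENNReal.ofReal A.sigmaZ
  bounded : ∀ᵐ z ∂P, ∀ j, |z.2 j| ≤ A.MX
  density : IsDensityOf P (fun z => β ⬝ᵥ z.2) f
  response : ResponseConditions A P Prod.fst Prod.snd β f m
  unit_response : ResponseConditions A P (fun _ => 1) Prod.snd β f (fun _ => 1)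

/-- `(Z i, X i)`, `i < n`, is an i.i.d. sample from `P`, and `βhat` is an estimator of `β` (a random
vector, with arbitrary dependence on the sample) with
`ℙ (‖βhat - β‖₁ > a) ≤ q`. -/
structure SampleConditions {n p : ℕ} {Ω : Type*} [MeasurableSpace Ω] (μ : Measure Ω)
    (P : Measure (ℝ × (Fin p → ℝ))) (Z : Fin n → Ω → ℝ) (X : Fin n → Ω → Fin p → ℝ)
    (β : Fin p → ℝ) (βhat : Ω → Fin p → ℝ) (a q : ℝ) : Prop where
  measurable_Z : ∀ i, Measurable (Z i)
  measurable_X : ∀ i, Measurable (X i)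
  law : ∀ i, μ.map (fun ω => (Z i ω, X i ω)) = P
  indep : iIndepFun (fun i ω => (Z i ω, X i ω)) μ
  measurable_βhat : Measurable βhat
  index_error : μ.real {ω | a < ∑ j, |βhat ω j - β j|} ≤ q

/-- The linear kernel average `(n h)⁻¹ ∑ i, zᵢ K ((b' xᵢ - b' x) / h)`. -/
def lHat (K : ℝ → ℝ) (h : ℝ) {n p : ℕ} (z : Fin n → ℝ) (xs : Fin n → Fin p → ℝ)
    (b x : Fin p → ℝ) : ℝ :=
  1 / (n * h) * ∑ i, z i * K ((b ⬝ᵥ xs i - b ⬝ᵥ x) / h)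

/-- The kernel density estimator `(n h)⁻¹ ∑ i, K ((b' xᵢ - b' x) / h)`. -/
def fHat (K : ℝ → ℝ) (h : ℝ) {n p : ℕ} (xs : Fin n → Fin p → ℝ) (b x : Fin p → ℝ) : ℝ :=
  1 / (n * h) * ∑ i, K ((b ⬝ᵥ xs i - b ⬝ᵥ x) / h)

/-- The ratio type (Nadaraya–Watson) estimator. -/
def mHat (K : ℝ → ℝ) (h : ℝ) {n p : ℕ} (z : Fin n → ℝ) (xs : Fin n → Fin p → ℝ)
    (b x : Fin p → ℝ) : ℝ :=
  lHat K h z xs b x / fHat K h xs b x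

/-- `bₙ = h² + a + a² / h² + log (n p) / (n h)`. -/
def bRate (n p : ℕ) (h a : ℝ) : ℝ :=
  h ^ 2 + a + a ^ 2 / h ^ 2 + Real.log (n * p) / (n * h)

/-- `εₙ(t) = C₁ (t + 1) / √(n h) + C₂ t² √(log n) / (n h) + C₃ bₙ`. -/
def epsRate (C₁ C₂ C₃ : ℝ) (n p : ℕ) (h a t : ℝ) : ℝ :=
  C₁ * ((t + 1) / √(n * h)) + C₂ * (t ^ 2 * √(Real.log n) / (n * h)) + C₃ * bRate n p h a

/-- The conditions on the dimensions `pₙ`, bandwidths `hₙ`, index error rates `aₙ` and error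
probabilities `qₙ`. -/
structure RateConditions (A : Constants) (p : ℕ → ℕ) (h a q : ℕ → ℝ) : Prop where
  p_pos : ∀ n, 2 ≤ n → 1 ≤ p n
  h_pos : ∀ n, 2 ≤ n → 0 < h n
  a_nonneg : ∀ n, 2 ≤ n → 0 ≤ a n
  q_mem : ∀ n, 2 ≤ n → q n ∈ Set.Icc (0 : ℝ) 1
  a_small : ∀ n, 2 ≤ n → 2 * A.MX * (a n / h n) ≤ A.L
  tendsto_a : Tendsto a atTop (𝓝 0)
  tendsto_q : Tendsto q atTop (𝓝 0)
  tendsto_h : Tendsto h atTop (𝓝 0)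
  tendsto_a_div_h : Tendsto (fun n => a n / h n) atTop (𝓝 0)
  tendsto_log : Tendsto (fun n => Real.log (n * p n) / (n * h n)) atTop (𝓝 0)
  tendsto_a_log : Tendsto (fun n => a n / h n * √(Real.log (p n))) atTop (𝓝 0)
  tendsto_b : Tendsto (fun n => bRate n (p n) (h n) (a n)) atTop (𝓝 0)

end SingleIndexKS

end

noncomputable section

namespace SingleIndexKS

/-! Expand `K` to second order around the true rescaled indices `u i = (β'X_i - β'x) / h`
(`abs_lHat_sub_le`). When `‖βhat - β‖₁ ≤ a`, every increment is at most `2 * MX * (a / h) ≤ L`, so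
the error of `lHat` is bounded by three terms: the error at `β`; `a / h` times the largest over `j`
of the averages of `Y K'(u) (X_j - x_j)`, by Hölder's inequality; and `(2 * MX * (a / h)) ^ 2` times
the average of `|Y| φ(u)`. These averages involve only the true index, so they are i.i.d. sums, and
the dependence of `βhat` on the sample is harmless.

Fluctuations: the summands are sub-Gaussian with variance of order `h` (`summand_bounds`), and a
Bernstein inequality (`bernstein_average`) puts each average within a multiple of `deviation` of its
mean. The union over `p` coordinates replaces `t²` by `t² + log p`; the prefactor `a / h` absorbs
this because `(a / h) √(log p) ≤ κ` (`mul_deviation_le_baseRate`). This is where the `1` in `t + 1`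
is used.

Means: the first average has bias of order `h²` (`mean_kernel_le`). Integration by parts makes the
gradient averages of order `h` in mean (`mean_gradient_le`), contributing `a / h * h = a`. The last
average is bounded in mean (`mean_abs_weight_le`), contributing `a² / h²`.

The responses `Z` and `1` give the two linear estimators, with failure probability at most `5 exp
(-t²) + q`, and `ratio_bound` handles the quotient. -/

/-! ### Exponential moments and a Bernstein inequality for sub-Gaussian variables. -/

lemma exp_le_one_add_add_sq_mul (x : ℝ) : Real.exp x ≤ 1 + x + x ^ 2 * Real.exp |x| := by
  have h := Complex.norm_exp_sub_sum_le_norm_mul_exp (x : ℂ) 2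
  have e : Complex.exp x - ∑ m ∈ Finset.range 2, (x : ℂ) ^ m / (m.factorial : ℂ)
      = ((Real.exp x - (1 + x) : ℝ) : ℂ) := by
    simp [Finset.sum_range_succ]
  rw [e, Complex.norm_real, Complex.norm_real, Real.norm_eq_abs, Real.norm_eq_abs, sq_abs] at h
  linarith [le_abs_self (Real.exp x - (1 + x))]

lemma log_natCast_ge {n : ℕ} (hn : 2 ≤ n) : 0.69 ≤ Real.log n := by
  have h : Real.log 2 ≤ Real.log n :=
    Real.log_le_log (by norm_num) (by exact_mod_cast hn)
  linarith [Real.log_two_gt_d9]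

lemma sqrt_log_natCast_ge {n : ℕ} (hn : 2 ≤ n) : 0.8 ≤ √(Real.log n) :=
  Real.le_sqrt_of_sq_le (by linarith [log_natCast_ge hn])

/-- The exponential of a multiple of `y` is dominated by a quadratic and a sub-Gaussian weight. -/
lemma exp_mul_le_quadratic_add {n : ℕ} (hn : 2 ≤ n) {s l y : ℝ} (hs : 0 < s)
    (hl : |l| * (3 * s * √(Real.log n)) ≤ 1) :
    Real.exp (l * y) ≤
      1 + l * y + l ^ 2 * (3 * y ^ 2 + 4 * s ^ 2 * Real.exp ((y / s) ^ 2) / n) := by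
  have hlog := log_natCast_ge hn
  have hn0 : (0 : ℝ) < n := by positivity
  have hw : 0 ≤ 4 * s ^ 2 * Real.exp ((y / s) ^ 2) / n := by positivity
  refine (exp_le_one_add_add_sq_mul (l * y)).trans ?_
  have key : y ^ 2 * Real.exp |l * y| ≤
      3 * y ^ 2 + 4 * s ^ 2 * Real.exp ((y / s) ^ 2) / n := by
    have hM : 0 < 3 * s * √(Real.log n) := by positivity
    set M := 3 * s * √(Real.log n) with hMdef
    have hl' : |l| ≤ 1 / M := by rwa [le_div_iff₀ hM]
    have hly : |l * y| ≤ |y| / M := by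
      rw [abs_mul, div_eq_inv_mul, ← one_div]
      exact mul_le_mul_of_nonneg_right hl' (abs_nonneg y)
    -- Below `M` the exponent is at most 1 and `e ≤ 3`. Above `M` one has `z ≥ 9 log n`, so the
    -- sub-Gaussian weight pays for the tail with a factor `1 / n` to spare, and no truncation is
    -- needed.
    rcases le_or_gt |y| M with h | h
    · have : Real.exp |l * y| ≤ 3 := by
        have h1 : |l * y| ≤ 1 := hly.trans ((div_le_one hM).2 h)
        linarith [Real.exp_le_exp.2 h1, Real.exp_one_lt_d9]
      nlinarith [sq_nonneg y]
    · set z := (y / s) ^ 2 with hz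
      have hys : y ^ 2 = s ^ 2 * z := by rw [hz]; field_simp
      have hM2 : M ^ 2 = s ^ 2 * (9 * Real.log n) := by
        rw [hMdef, mul_pow, Real.sq_sqrt (by linarith)]; ring
      have hzl : 9 * Real.log n ≤ z := by
        have : M ^ 2 ≤ y ^ 2 := by rw [← sq_abs y]; gcongr
        rw [hM2, hys] at this
        exact le_of_mul_le_mul_left this (by positivity)
      -- Here `|y| / M ≤ (y / M) ^ 2 = z / (9 log n)`, and `9 * 0.69 > 4`.
      have h1 : |l * y| ≤ z / 4 := by
        have h2 : |y| / M ≤ y ^ 2 / M ^ 2 := by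
          rw [← sq_abs y, ← div_pow, pow_two]
          exact le_mul_of_one_le_left (by positivity) ((one_le_div hM).2 h.le)
        have h3 : y ^ 2 / M ^ 2 ≤ z / 4 := by
          rw [hM2, hys, mul_div_mul_left _ _ (by positivity)]
          exact div_le_div_of_nonneg_left (by positivity) (by norm_num) (by linarith)
        exact hly.trans (h2.trans h3)
      have h4 : z ≤ 4 * Real.exp (z / 4) := by linarith [Real.add_one_le_exp (z / 4)]
      have h5 : Real.exp (z / 2) ≤ Real.exp z / n := by
        rw [le_div_iff₀ hn0]
        calc Real.exp (z / 2) * n = Real.exp (z / 2) * Real.exp (Real.log n) := by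
              rw [Real.exp_log hn0]
          _ ≤ Real.exp (z / 2) * Real.exp (z / 2) := by gcongr; linarith
          _ = Real.exp z := by rw [← Real.exp_add]; ring_nf
      calc y ^ 2 * Real.exp |l * y| ≤ s ^ 2 * z * Real.exp (z / 4) := by rw [hys]; gcongr
        _ ≤ s ^ 2 * (4 * Real.exp (z / 4)) * Real.exp (z / 4) := by gcongr
        _ = 4 * s ^ 2 * Real.exp (z / 2) := by
          have : Real.exp (z / 2) = Real.exp (z / 4) * Real.exp (z / 4) := by
            rw [← Real.exp_add]; ring_nf
          rw [this]; ring
        _ ≤ 4 * s ^ 2 * (Real.exp z / n) := by gcongr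
        _ = 4 * s ^ 2 * Real.exp z / n := by ring
        _ ≤ _ := by nlinarith [sq_nonneg y]
  nlinarith [mul_le_mul_of_nonneg_left key (sq_nonneg l)]

/-- A quantitative form of sub-Gaussianity: `E exp ((Y / s) ^ 2) ≤ 2`. -/
structure SquareExpBound {E : Type*} [MeasurableSpace E] (P : Measure E) (Y : E → ℝ)
    (s : ℝ) : Prop where
  integrable : Integrable (fun z => Real.exp ((Y z / s) ^ 2)) P
  integral_le : ∫ z, Real.exp ((Y z / s) ^ 2) ∂P ≤ 2

section Bernstein

variable {E : Type*} [MeasurableSpace E] {P : Measure E} [IsProbabilityMeasure P]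
  {ξ : E → ℝ} {s v : ℝ}

omit [IsProbabilityMeasure P] in
lemma SquareExpBound.integrable_sq (hξ : SquareExpBound P ξ s) (hm : Measurable ξ) (hs : 0 < s) :
    Integrable (fun z => ξ z ^ 2) P := by
  refine Integrable.mono' (hξ.integrable.const_mul (s ^ 2))
    (hm.pow_const 2).aestronglyMeasurable (ae_of_all _ fun z => ?_)
  rw [Real.norm_eq_abs, abs_of_nonneg (sq_nonneg _)]
  have h1 : ξ z ^ 2 = s ^ 2 * (ξ z / s) ^ 2 := by field_simp
  rw [h1]
  gcongr
  linarith [Real.add_one_le_exp ((ξ z / s) ^ 2)]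

lemma SquareExpBound.integrable_self (hξ : SquareExpBound P ξ s) (hm : Measurable ξ)
    (hs : 0 < s) : Integrable ξ P := by
  refine Integrable.mono' ((hξ.integrable_sq hm hs).add (integrable_const 1))
    hm.aestronglyMeasurable (ae_of_all _ fun z => ?_)
  rw [Real.norm_eq_abs]
  simp only [Pi.add_apply]
  nlinarith [sq_nonneg (|ξ z| - 1), sq_abs (ξ z), abs_nonneg (ξ z)]

omit [IsProbabilityMeasure P] in
lemma SquareExpBound.neg (hξ : SquareExpBound P ξ s) : SquareExpBound P (fun z => -ξ z) s := by
  have e : (fun z => Real.exp ((-ξ z / s) ^ 2)) = fun z => Real.exp ((ξ z / s) ^ 2) := by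
    funext z; rw [neg_div, neg_sq]
  exact ⟨by rw [e]; exact hξ.integrable, by rw [e]; exact hξ.integral_le⟩

omit [IsProbabilityMeasure P] in
lemma SquareExpBound.of_le {Y : E → ℝ} {r : ℝ} (hY : SquareExpBound P Y s) (hm : Measurable ξ)
    (hr : 0 < r) (hs : 0 < s)
    (hle : ∀ᵐ z ∂P, |ξ z| ≤ r * |Y z|) : SquareExpBound P ξ (s * r) := by
  have h : ∀ᵐ z ∂P, Real.exp ((ξ z / (s * r)) ^ 2) ≤ Real.exp ((Y z / s) ^ 2) := by
    filter_upwards [hle] with z hz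
    rw [Real.exp_le_exp, ← sq_abs, ← sq_abs (Y z / s), abs_div, abs_div, abs_of_pos hs,
      abs_of_pos (mul_pos hs hr)]
    refine pow_le_pow_left₀ (by positivity) ?_ 2
    rw [div_le_div_iff₀ (by positivity) hs]
    nlinarith
  have hi : Integrable (fun z => Real.exp ((ξ z / (s * r)) ^ 2)) P := by
    refine hY.integrable.mono' (by fun_prop) ?_
    filter_upwards [h] with z hz
    rwa [Real.norm_eq_abs, abs_of_pos (Real.exp_pos _)]
  exact ⟨hi, (integral_mono_ae hi hY.integrable h).trans hY.integral_le⟩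

/-- Integrate the pointwise bound `exp_mul_le_quadratic_add`. The weight has integral at most 2, so
its contribution `8 s² / n` stays bounded when summed over the sample. -/
lemma SquareExpBound.mgf_le (hξ : SquareExpBound P ξ s) (hm : Measurable ξ) (hs : 0 < s)
    (hv : ∫ z, ξ z ^ 2 ∂P ≤ v) {n : ℕ} (hn : 2 ≤ n) {l : ℝ}
    (hl : |l| * (3 * s * √(Real.log n)) ≤ 1) :
    Integrable (fun z => Real.exp (l * ξ z)) P ∧
    mgf ξ P l ≤ Real.exp (l * (∫ z, ξ z ∂P) + l ^ 2 * (3 * v + 8 * s ^ 2 / n)) := by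
  have h1 := hξ.integrable_self hm hs
  have h2 := hξ.integrable_sq hm hs
  have h3 := hξ.integrable
  have hb : Integrable (fun z => 1 + l * ξ z + l ^ 2 * (3 * ξ z ^ 2 +
      4 * s ^ 2 * Real.exp ((ξ z / s) ^ 2) / n)) P := by
    refine ((integrable_const _).add (h1.const_mul _)).add (Integrable.const_mul ?_ _)
    exact (h2.const_mul _).add ((h3.const_mul _).div_const _)
  have hle : ∀ z, Real.exp (l * ξ z) ≤ 1 + l * ξ z + l ^ 2 * (3 * ξ z ^ 2 +
      4 * s ^ 2 * Real.exp ((ξ z / s) ^ 2) / n) := fun z => exp_mul_le_quadratic_add hn hs hl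
  have hi : Integrable (fun z => Real.exp (l * ξ z)) P := by
    refine hb.mono' (by fun_prop) (ae_of_all _ fun z => ?_)
    rw [Real.norm_eq_abs, abs_of_pos (Real.exp_pos _)]
    exact hle z
  refine ⟨hi, ?_⟩
  have hn0 : (0 : ℝ) < n := by positivity
  calc mgf ξ P l ≤ ∫ z, (1 + l * ξ z + l ^ 2 * (3 * ξ z ^ 2 +
      4 * s ^ 2 * Real.exp ((ξ z / s) ^ 2) / n)) ∂P := integral_mono hi hb hle
    _ = 1 + l * (∫ z, ξ z ∂P) + l ^ 2 * (3 * (∫ z, ξ z ^ 2 ∂P) +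
      4 * s ^ 2 * (∫ z, Real.exp ((ξ z / s) ^ 2) ∂P) / n) := by
      have i1 : Integrable (fun z => l * ξ z) P := h1.const_mul _
      have i2 : Integrable (fun z => 1 + l * ξ z) P := (integrable_const _).add i1
      have i3 : Integrable (fun z => 3 * ξ z ^ 2) P := h2.const_mul _
      have i4 : Integrable (fun z => 4 * s ^ 2 * Real.exp ((ξ z / s) ^ 2) / n) P :=
        (h3.const_mul _).div_const _
      have i5 : Integrable (fun z => l ^ 2 * (3 * ξ z ^ 2 +
          4 * s ^ 2 * Real.exp ((ξ z / s) ^ 2) / n)) P := (i3.add i4).const_mul _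
      rw [integral_add i2 i5, integral_add (integrable_const _) i1,
        integral_const_mul, integral_const_mul, integral_add i3 i4, integral_const_mul,
        integral_div, integral_const_mul]
      simp
    _ ≤ 1 + l * (∫ z, ξ z ∂P) + l ^ 2 * (3 * v + 4 * s ^ 2 * 2 / n) := by
      gcongr
      exact hξ.integral_le
    _ ≤ _ := by
      refine le_trans (le_of_eq ?_) (Real.add_one_le_exp _)
      ring

variable {Ω : Type*} [MeasurableSpace Ω] {μ : Measure Ω} [IsProbabilityMeasure μ] {n : ℕ}
  {ζ : Fin n → Ω → E}

/-- One-sided Bernstein inequality for sums of i.i.d. sub-Gaussian variables. -/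
lemma bernstein_upper (hζ : ∀ i, Measurable (ζ i)) (hlaw : ∀ i, μ.map (ζ i) = P)
    (hind : iIndepFun ζ μ) (hξ : SquareExpBound P ξ s) (hm : Measurable ξ) (hs : 0 < s)
    (hv : ∫ z, ξ z ^ 2 ∂P ≤ v) (hn : 2 ≤ n) {τ : ℝ} (hτ : 0 ≤ τ) :
    μ.real {ω | 2 * √(n * (3 * v + 8 * s ^ 2 / n)) * τ + 3 * s * √(Real.log n) * τ ^ 2 ≤
      ∑ i, (ξ (ζ i ω) - ∫ z, ξ z ∂P)} ≤ Real.exp (-τ ^ 2) := by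
  have hlog := log_natCast_ge hn
  have hn0 : (0 : ℝ) < n := by positivity
  have hv0 : 0 ≤ v := (integral_nonneg fun z => sq_nonneg (ξ z)).trans hv
  set e := ∫ z, ξ z ∂P with he
  set V := 3 * v + 8 * s ^ 2 / n with hV
  have hVp : 0 < V := by positivity
  set M := 3 * s * √(Real.log n) with hM
  have hMp : 0 < M := by positivity
  set R := √(n * V) with hR
  have hRp : 0 < R := by positivity
  have hR2 : R ^ 2 = n * V := Real.sq_sqrt (by positivity)
  have chernoff : ∀ l, 0 ≤ l → l * M ≤ 1 → ∀ r, μ.real {ω | r ≤ ∑ i, (ξ (ζ i ω) - e)} ≤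
      Real.exp (-l * r + l ^ 2 * (n * V)) := by
    intro l hl hlM r
    obtain ⟨hi, hmgf⟩ := hξ.mgf_le hm hs hv hn (l := l) (by rwa [abs_of_nonneg hl])
    set U : Fin n → Ω → ℝ := fun i ω => ξ (ζ i ω) - e with hU
    have hUm : ∀ i, Measurable (U i) := fun i => (hm.comp (hζ i)).sub_const e
    have hUind : iIndepFun U μ := hind.comp (fun _ z => ξ z - e) (fun _ => hm.sub_const e)
    have hUi : ∀ i, Integrable (fun ω => Real.exp (l * U i ω)) μ := by
      intro i
      have : Integrable (fun z => Real.exp (l * (ξ z - e))) P := by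
        have h := hi.const_mul (Real.exp (-(l * e)))
        refine h.congr (ae_of_all _ fun z => ?_)
        simp only
        rw [← Real.exp_add]; ring_nf
      rw [← hlaw i] at this
      exact this.comp_measurable (hζ i)
    have hUmgf : ∀ i, mgf (U i) μ l ≤ Real.exp (l ^ 2 * V) := by
      intro i
      have h1 : mgf (U i) μ l = mgf ξ P l * Real.exp (-(l * e)) := by
        rw [← hlaw i, mgf_map (hζ i).aemeasurable (by fun_prop), mgf, mgf, ← integral_mul_const]
        refine integral_congr_ae (ae_of_all _ fun ω => ?_)
        simp only [hU, Function.comp]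
        rw [← Real.exp_add]; ring_nf
      rw [h1]
      calc mgf ξ P l * Real.exp (-(l * e)) ≤
          Real.exp (l * e + l ^ 2 * V) * Real.exp (-(l * e)) := by gcongr
        _ = Real.exp (l ^ 2 * V) := by rw [← Real.exp_add]; ring_nf
    have hsumeq : (fun ω => ∑ i, (ξ (ζ i ω) - e)) = ∑ i, U i := by
      funext ω; simp [hU, Finset.sum_apply]
    have hset : {ω | r ≤ ∑ i, (ξ (ζ i ω) - e)} = {ω | r ≤ (∑ i, U i) ω} := by
      rw [← hsumeq]
    rw [hset]
    refine (measure_ge_le_exp_mul_mgf r hl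
      (hUind.integrable_exp_mul_sum hUm (fun i _ => hUi i))).trans ?_
    rw [hUind.mgf_sum hUm, Real.exp_add]
    gcongr
    calc ∏ i, mgf (U i) μ l ≤ ∏ _i : Fin n, Real.exp (l ^ 2 * V) :=
          Finset.prod_le_prod (fun i _ => mgf_nonneg) (fun i _ => hUmgf i)
      _ = Real.exp (l ^ 2 * (n * V)) := by
        rw [Finset.prod_const, ← Real.exp_nat_mul]
        simp only [Finset.card_univ, Fintype.card_fin]
        ring_nf
  -- For the part `2 * R * τ` of the radius the optimal Chernoff parameter is `τ / R`; it is capped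
  -- at the largest admissible value `1 / M`.
  rcases le_or_gt (τ * M) R with h | h
  · refine (chernoff (τ / R) (by positivity) ?_ _).trans (Real.exp_le_exp.2 ?_)
    · rw [div_mul_eq_mul_div]; exact (div_le_one hRp).2 h
    · rw [← hR2]
      have h1 : -(τ / R) * (2 * R * τ + M * τ ^ 2) + (τ / R) ^ 2 * R ^ 2 =
          -τ ^ 2 - τ ^ 3 * M / R := by field_simp; ring
      rw [h1]
      have : 0 ≤ τ ^ 3 * M / R := by positivity
      linarith
  · refine (chernoff (1 / M) (by positivity) ?_ _).trans (Real.exp_le_exp.2 ?_)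
    · rw [one_div_mul_cancel hMp.ne']
    · rw [← hR2]
      have h1 : -(1 / M) * (2 * R * τ + M * τ ^ 2) + (1 / M) ^ 2 * R ^ 2 =
          -τ ^ 2 - R * (2 * (τ * M) - R) / M ^ 2 := by field_simp; ring
      rw [h1]
      have : 0 ≤ R * (2 * (τ * M) - R) / M ^ 2 := by
        have : 0 ≤ 2 * (τ * M) - R := by linarith
        positivity
      linarith

/-- The size of the deviations of a kernel average. -/
def deviation (n : ℕ) (h τ : ℝ) : ℝ :=
  τ / √(n * h) + τ ^ 2 * √(Real.log n) / (n * h) + Real.log n / (n * h)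

/-- The root splits because `3c ≤ (1 + c)²` and `8 ≤ 9`. The leftover `6 s τ` is shared between `τ²
√(log n)` and `log n` through `2τ ≤ 1 + τ²`; this produces the last term of `deviation` and the
factor 7. -/
lemma bernstein_radius_le (hn : 2 ≤ n) {c h Q τ : ℝ} (hc : 0 ≤ c) (hh : 0 < h) (hs : 0 < s)
    (hτ : 0 ≤ τ) (hQ : 2 + 2 * c + 7 * s ≤ Q) :
    2 * √(n * (3 * (c * h) + 8 * s ^ 2 / n)) * τ + 3 * s * √(Real.log n) * τ ^ 2 ≤
      (n * h) * (Q * deviation n h τ) := by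
  have hlog := log_natCast_ge hn
  have hsl := sqrt_log_natCast_ge hn
  have hn0 : (0 : ℝ) < n := by positivity
  have hN : 0 < n * h := by positivity
  set N := n * h with hNdef
  have hsN : 0 < √N := Real.sqrt_pos.2 hN
  have hNN : N / √N = √N := Real.div_sqrt
  have h1 : √(n * (3 * (c * h) + 8 * s ^ 2 / n)) ≤ (1 + c) * √N + 3 * s := by
    rw [Real.sqrt_le_left (by positivity)]
    have e1 : n * (3 * (c * h) + 8 * s ^ 2 / n) = 3 * c * N + 8 * s ^ 2 := by
      rw [hNdef]; field_simp
    rw [e1]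
    have e2 : √N ^ 2 = N := Real.sq_sqrt hN.le
    have : 3 * c * N ≤ (1 + c) ^ 2 * √N ^ 2 := by
      rw [e2]
      nlinarith [sq_nonneg (2 * c - 1), sq_nonneg (c - 1), sq_nonneg c]
    nlinarith [mul_pos hsN hs, mul_nonneg hc (mul_pos hsN hs).le]
  have e3 : (n * h) * (Q * deviation n h τ) =
      Q * (√N * τ + τ ^ 2 * √(Real.log n) + Real.log n) := by
    have hd : deviation n h τ = τ / √N + τ ^ 2 * √(Real.log n) / N + Real.log n / N := rfl
    have e4 : N * (τ / √N) = √N * τ := by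
      rw [← mul_div_assoc, mul_div_right_comm, hNN]
    rw [hd, ← hNdef, ← e4]
    field_simp
  rw [e3]
  have a1 : 0 ≤ √N * τ := by positivity
  have a2 : 0 ≤ τ ^ 2 * √(Real.log n) := by positivity
  have b1 : (2 + 2 * c) * (√N * τ) ≤ Q * (√N * τ) := by gcongr; linarith
  have b2 : 7 * s * (τ ^ 2 * √(Real.log n) + Real.log n) ≤
      Q * (τ ^ 2 * √(Real.log n) + Real.log n) := by gcongr; linarith
  have b3 : s * τ ≤ s * ((1 + τ ^ 2) / 2) := by
    gcongr; nlinarith [sq_nonneg (τ - 1)]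
  have b4 : s * τ ^ 2 * 0.8 ≤ s * τ ^ 2 * √(Real.log n) := by gcongr
  have b5 : s * 0.69 ≤ s * Real.log n := by gcongr
  nlinarith [mul_le_mul_of_nonneg_right h1 hτ]

lemma bernstein_average_upper (hζ : ∀ i, Measurable (ζ i)) (hlaw : ∀ i, μ.map (ζ i) = P)
    (hind : iIndepFun ζ μ) (hξ : SquareExpBound P ξ s) (hm : Measurable ξ) (hs : 0 < s)
    {c h Q τ : ℝ} (hc : 0 ≤ c) (hh : 0 < h) (hv : ∫ z, ξ z ^ 2 ∂P ≤ c * h) (hn : 2 ≤ n)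
    (hQ : 2 + 2 * c + 7 * s ≤ Q) (hτ : 0 ≤ τ) :
    μ.real {ω | Q * deviation n h τ < 1 / (n * h) * ∑ i, ξ (ζ i ω) - (∫ z, ξ z ∂P) / h} ≤
      Real.exp (-τ ^ 2) := by
  refine le_trans (measureReal_mono ?_)
    (bernstein_upper hζ hlaw hind hξ hm hs hv hn hτ)
  intro ω hω
  simp only [Set.mem_ofPred_eq] at hω ⊢
  have hn0 : (0 : ℝ) < n := by positivity
  have hN : 0 < n * h := by positivity
  refine (bernstein_radius_le hn hc hh hs hτ hQ).trans ?_
  have h1 := mul_le_mul_of_nonneg_left hω.le hN.le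
  refine h1.trans (le_of_eq ?_)
  rw [Finset.sum_sub_distrib]
  simp only [Finset.sum_const, Finset.card_univ, Fintype.card_fin, nsmul_eq_mul]
  field_simp

lemma bernstein_average (hζ : ∀ i, Measurable (ζ i)) (hlaw : ∀ i, μ.map (ζ i) = P)
    (hind : iIndepFun ζ μ) (hξ : SquareExpBound P ξ s) (hm : Measurable ξ) (hs : 0 < s)
    {c h Q τ : ℝ} (hc : 0 ≤ c) (hh : 0 < h) (hv : ∫ z, ξ z ^ 2 ∂P ≤ c * h) (hn : 2 ≤ n)
    (hQ : 2 + 2 * c + 7 * s ≤ Q) (hτ : 0 ≤ τ) :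
    μ.real {ω | Q * deviation n h τ < |1 / (n * h) * ∑ i, ξ (ζ i ω) - (∫ z, ξ z ∂P) / h|} ≤
      2 * Real.exp (-τ ^ 2) := by
  have h1 := bernstein_average_upper hζ hlaw hind hξ hm hs hc hh hv hn hQ hτ
  have h2 := bernstein_average_upper hζ hlaw hind hξ.neg hm.neg hs hc hh
    (by simpa only [neg_sq] using hv) hn hQ hτ
  rw [two_mul]
  refine le_trans ?_ (add_le_add h1 h2)
  refine le_trans (measureReal_mono ?_) (measureReal_union_le _ _)
  intro ω hω
  simp only [Set.mem_ofPred_eq, lt_abs] at hω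
  rcases hω with hω | hω
  · exact Or.inl hω
  · refine Or.inr ?_
    simp only [Set.mem_ofPred_eq, Finset.sum_neg_distrib, integral_neg]
    refine hω.trans_eq ?_
    ring

end Bernstein

/-! ### Moments of kernel weights through the regression function and the index density. -/

section Regression

variable {E : Type*} [MeasurableSpace E] {P : Measure E} [IsProbabilityMeasure P]
  {W Y : E → ℝ} {f g : ℝ → ℝ}

omit [IsProbabilityMeasure P] in
lemma IsDensityOf.integrable_comp_iff (hd : IsDensityOf P W f) (hW : Measurable W)
    {F : ℝ → ℝ} (hF : Measurable F) :
    Integrable (fun z => F (W z)) P ↔ Integrable (fun u => F u * f u) := by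
  have h1 : Integrable (fun z => F (W z)) P ↔ Integrable F (P.map W) :=
    (integrable_map_measure hF.aestronglyMeasurable hW.aemeasurable).symm
  rw [h1, hd.map_eq, integrable_withDensity_iff hd.measurable.ennreal_ofReal (by simp)]
  simp only [ENNReal.toReal_ofReal (hd.nonneg _)]

omit [IsProbabilityMeasure P] in
lemma IsDensityOf.integral_comp (hd : IsDensityOf P W f) (hW : Measurable W)
    {F : ℝ → ℝ} (hF : Measurable F) : ∫ z, F (W z) ∂P = ∫ u, F u * f u := by
  rw [← integral_map hW.aemeasurable hF.aestronglyMeasurable, hd.map_eq,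
    integral_withDensity_eq_integral_toReal_smul hd.measurable.ennreal_ofReal (by simp)]
  refine integral_congr_ae (ae_of_all _ fun u => ?_)
  simp only [ENNReal.toReal_ofReal (hd.nonneg _), smul_eq_mul, mul_comm]

/-- Pulling `ψ (W)` out of the conditional expectation replaces `Y` by `g (W)`, and the density of
`W` turns the result into a Lebesgue integral. Boundedness of `ψ` supplies the integrability. -/
lemma IsRegressionFunction.integral_mul_comp (hr : IsRegressionFunction P Y W g)
    (hd : IsDensityOf P W f) (hW : Measurable W) {ψ : ℝ → ℝ} (hψ : Measurable ψ) {B : ℝ}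
    (hB : ∀ u, |ψ u| ≤ B) :
    Integrable (fun z => Y z * ψ (W z)) P ∧ Integrable (fun u => ψ u * (g u * f u)) ∧
      ∫ z, Y z * ψ (W z) ∂P = ∫ u, ψ u * (g u * f u) := by
  have hm : MeasurableSpace.comap W inferInstance ≤ (inferInstance : MeasurableSpace E) :=
    hW.comap_le
  have hi : Integrable (fun z => ψ (W z) * Y z) P :=
    hr.integrable.bdd_mul (hψ.comp hW).aestronglyMeasurable (ae_of_all _ fun z => hB (W z))
  have hψW : StronglyMeasurable[MeasurableSpace.comap W inferInstance] (fun z => ψ (W z)) :=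
    (hψ.comp (comap_measurable W)).stronglyMeasurable
  have hce := condExp_mul_of_stronglyMeasurable_left (μ := P) hψW hi hr.integrable
  have hce' : P[(fun z => ψ (W z)) * Y | MeasurableSpace.comap W inferInstance] =ᵐ[P]
      fun z => ψ (W z) * g (W z) := by
    filter_upwards [hce, hr.condExp_eq] with z h1 h2
    rw [h1, Pi.mul_apply, h2]
  have hF : Measurable fun u => ψ u * g u := hψ.mul hr.measurable
  have hFi : Integrable (fun z => ψ (W z) * g (W z)) P := integrable_condExp.congr hce'
  have e1 : (fun u => ψ u * (g u * f u)) = fun u => ψ u * g u * f u := by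
    funext u; ring
  have e2 : (fun z => Y z * ψ (W z)) = (fun z => ψ (W z)) * Y := by
    funext z; simp [mul_comm]
  rw [e1, e2]
  refine ⟨hi, (hd.integrable_comp_iff hW hF).1 hFi, ?_⟩
  rw [← integral_condExp hm, integral_congr_ae hce']
  exact hd.integral_comp hW hF

lemma integral_comp_affine (F : ℝ → ℝ) (w : ℝ) {h : ℝ} (hh : 0 < h) :
    ∫ u, F u = h * ∫ u, F (w + h * u) := by
  have h1 := Measure.integral_comp_mul_left (fun u => F (w + u)) h
  rw [h1, integral_add_left_eq_self, abs_of_pos (inv_pos.2 hh), smul_eq_mul,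
    mul_inv_cancel_left₀ hh.ne']

lemma integrable_comp_affine_iff (F : ℝ → ℝ) (w : ℝ) {h : ℝ} (hh : 0 < h) :
    Integrable (fun u => F (w + h * u)) ↔ Integrable F := by
  rw [integrable_comp_mul_left_iff (fun u => F (w + u)) hh.ne']
  exact ⟨fun H => by simpa using H.comp_add_left (-w), fun H => H.comp_add_left w⟩

/-- Moments of kernel weights in terms of the regression function and the density of the index. -/
lemma IsRegressionFunction.integral_mul_kernel (hr : IsRegressionFunction P Y W g)
    (hd : IsDensityOf P W f) (hW : Measurable W) {ψ : ℝ → ℝ} (hψ : Measurable ψ) {B : ℝ}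
    (hB : ∀ u, |ψ u| ≤ B) (w : ℝ) {h : ℝ} (hh : 0 < h) :
    Integrable (fun z => Y z * ψ ((W z - w) / h)) P ∧
    Integrable (fun u => ψ u * (g (w + h * u) * f (w + h * u))) ∧
      ∫ z, Y z * ψ ((W z - w) / h) ∂P = h * ∫ u, ψ u * (g (w + h * u) * f (w + h * u)) := by
  obtain ⟨h1, h2, h3⟩ := hr.integral_mul_comp hd hW (ψ := fun u => ψ ((u - w) / h))
    (by fun_prop) (fun u => hB _)
  have e : ∀ u, (w + h * u - w) / h = u := fun u => by field_simp; ring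
  refine ⟨h1, ?_, ?_⟩
  · rw [← integrable_comp_affine_iff _ w hh] at h2
    simpa only [e] using h2
  · rw [h3, integral_comp_affine _ w hh]
    simp only [e]

/-- The change of variables contributes the factor `h`, which is behind both the variance bound and
the bound for the quadratic remainder. -/
lemma IsRegressionFunction.abs_integral_mul_kernel_le (hr : IsRegressionFunction P Y W g)
    (hd : IsDensityOf P W f) (hW : Measurable W) {ψ : ℝ → ℝ} (hψ : Measurable ψ) {B : ℝ}
    (hB : ∀ u, |ψ u| ≤ B) (hψi : Integrable ψ) {C : ℝ} (hC : ∀ u, |g u * f u| ≤ C)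
    (w : ℝ) {h : ℝ} (hh : 0 < h) :
    |∫ z, Y z * ψ ((W z - w) / h) ∂P| ≤ C * (∫ u, |ψ u|) * h := by
  obtain ⟨-, h2, h3⟩ := hr.integral_mul_kernel hd hW hψ hB w hh
  rw [h3, abs_mul, abs_of_pos hh, mul_comm]
  gcongr
  refine abs_integral_le_integral_abs.trans ?_
  rw [← integral_const_mul]
  refine integral_mono h2.abs (hψi.abs.const_mul C) fun u => ?_
  simp only
  rw [abs_mul, mul_comm]
  gcongr
  exact hC _

end Regression

/-- Mean value inequality for `t ↦ F t - deriv F u * t` on a ball; it serves both the bias expansion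
and the expansion of the kernel. -/
lemma abs_sub_sub_deriv_mul_le {F : ℝ → ℝ} (hF : Differentiable ℝ F) {u d C : ℝ}
    (hC : ∀ t, |t - u| ≤ |d| → |deriv F t - deriv F u| ≤ C) :
    |F (u + d) - F u - deriv F u * d| ≤ C * |d| := by
  have h := (convex_closedBall u |d|).norm_image_sub_le_of_norm_hasDerivWithin_le
    (f := fun t => F t - deriv F u * t) (f' := fun t => deriv F t - deriv F u) (C := C)
    (fun t _ => ((hF t).hasDerivAt.sub
      (by simpa using (hasDerivAt_id t).const_mul (deriv F u))).hasDerivWithinAt)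
    (fun t ht => hC t (by simpa [Real.dist_eq] using ht))
    (x := u) (y := u + d) (by simp) (by simp)
  simp only [Real.norm_eq_abs, add_sub_cancel_left] at h
  refine le_trans (le_of_eq ?_) h
  congr 1; ring

/-! ### Analytic properties of the kernel: bias, integration by parts, expansion. -/

section Kernel

variable {A : Constants} {K : ℝ → ℝ}

lemma KernelConditions.integrable_mul (hK : KernelConditions A K) :
    Integrable fun u => u * K u := by
  refine (hK.integrable.abs.add hK.integrable_sq).mono' (by
    have := hK.contDiff.continuous
    fun_prop) (ae_of_all _ fun u => ?_)
  simp only [Pi.add_apply, Real.norm_eq_abs, abs_mul]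
  nlinarith [abs_nonneg (K u), sq_nonneg (|u| - 1), sq_abs u, abs_nonneg u]

/-- Taylor expansion at `w`: the constant term reproduces `l w` since `∫ K = 1`, the linear term
vanishes with the first moment, and the remainder is at most `B2 (h u)²`; the factor 1/2 is not
sought. -/
lemma KernelConditions.bias_le (hK : KernelConditions A K) {l : ℝ → ℝ} (hl : ContDiff ℝ 2 l)
    (hl2 : ∀ w, |iteratedDeriv 2 l w| ≤ A.B2) (w : ℝ) {h : ℝ} (hh : 0 < h)
    (hi : Integrable fun u => K u * l (w + h * u)) :
    |(∫ u, K u * l (w + h * u)) - l w| ≤ A.B2 * A.RK * h ^ 2 := by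
  have hl1 : Differentiable ℝ l := hl.differentiable (by norm_num)
  have hl' : ∀ t, |deriv l t - deriv l w| ≤ A.B2 * |t - w| := by
    intro t
    have hd : Differentiable ℝ (deriv l) := by
      have := hl.differentiable_iteratedDeriv 1 (by norm_num)
      rwa [iteratedDeriv_one] at this
    have := convex_univ.norm_image_sub_le_of_norm_deriv_le (f := deriv l) (C := A.B2)
      (fun x _ => hd x) (fun x _ => by
        have e : iteratedDeriv 2 l = deriv (deriv l) := by
          rw [iteratedDeriv_succ, iteratedDeriv_one]
        rw [← e]; exact hl2 x) (Set.mem_univ w) (Set.mem_univ t)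
    simpa [Real.norm_eq_abs] using this
  have hB2 : 0 ≤ A.B2 := (abs_nonneg _).trans (hl2 0)
  have hT : ∀ u, |l (w + h * u) - l w - deriv l w * (h * u)| ≤ A.B2 * (h ^ 2 * u ^ 2) := by
    intro u
    refine (abs_sub_sub_deriv_mul_le hl1 (C := A.B2 * |h * u|) (fun t ht => ?_)).trans
      (le_of_eq ?_)
    · exact (hl' t).trans (by gcongr)
    · rw [mul_assoc, ← pow_two, sq_abs, mul_pow]
  have hi2 : Integrable fun u => l w * K u := hK.integrable.const_mul _
  have hi3 : Integrable fun u => deriv l w * h * (u * K u) := hK.integrable_mul.const_mul _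
  have hi4 : Integrable fun u => K u * (l (w + h * u) - l w - deriv l w * (h * u)) := by
    refine ((hi.sub hi2).sub hi3).congr (ae_of_all _ fun u => ?_)
    simp only [Pi.sub_apply]; ring
  have e : (∫ u, K u * l (w + h * u)) - l w =
      ∫ u, K u * (l (w + h * u) - l w - deriv l w * (h * u)) := by
    have e1 : ∫ u, K u * (l (w + h * u) - l w - deriv l w * (h * u)) =
        ∫ u, (K u * l (w + h * u) - l w * K u - deriv l w * h * (u * K u)) := by
      congr 1; funext u; ring
    have hi5 : Integrable fun u => K u * l (w + h * u) - l w * K u := hi.sub hi2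
    rw [e1, integral_sub hi5 hi3, integral_sub hi hi2, integral_const_mul,
      integral_const_mul, hK.integral_eq_one, hK.integral_mul_eq_zero]
    ring
  rw [e]
  calc |∫ u, K u * (l (w + h * u) - l w - deriv l w * (h * u))|
      ≤ ∫ u, |K u * (l (w + h * u) - l w - deriv l w * (h * u))| := abs_integral_le_integral_abs
    _ ≤ ∫ u, A.B2 * h ^ 2 * (u ^ 2 * |K u|) := by
      refine integral_mono hi4.abs (hK.integrable_sq.const_mul _) fun u => ?_
      simp only
      rw [abs_mul]
      calc |K u| * |l (w + h * u) - l w - deriv l w * (h * u)| ≤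
            |K u| * (A.B2 * (h ^ 2 * u ^ 2)) := by gcongr; exact hT u
        _ = _ := by ring
    _ = A.B2 * h ^ 2 * ∫ u, u ^ 2 * |K u| := integral_const_mul _ _
    _ ≤ A.B2 * h ^ 2 * A.RK := by gcongr; exact hK.integral_sq_le
    _ = _ := by ring

/-- Integration by parts moves the derivative onto `u ↦ η (w + h u)`, which releases a factor `h`.
Integrability of the three products leaves no boundary terms. -/
lemma KernelConditions.integral_deriv_mul_le (hK : KernelConditions A K) {η : ℝ → ℝ} {B : ℝ}
    (hη : ContDiff ℝ 1 η) (hη' : ∀ w, |deriv η w| ≤ B) (w : ℝ) {h : ℝ} (hh : 0 < h)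
    (hi : Integrable fun u => K u * η (w + h * u))
    (hi' : Integrable fun u => deriv K u * η (w + h * u)) :
    |∫ u, deriv K u * η (w + h * u)| ≤ A.CK * B * h := by
  have hB : 0 ≤ B := (abs_nonneg _).trans (hη' 0)
  have hηd : Differentiable ℝ η := hη.differentiable (by norm_num)
  have hKd : Differentiable ℝ K := hK.contDiff.differentiable (by norm_num)
  have hv : ∀ u, HasDerivAt (fun u => η (w + h * u)) (deriv η (w + h * u) * h) u := by
    intro u
    have h1 : HasDerivAt (fun u => w + h * u) h u := by
      simpa using ((hasDerivAt_id u).const_mul h).const_add w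
    exact (hηd (w + h * u)).hasDerivAt.comp u h1
  have hb : ∀ u, |deriv η (w + h * u) * h| ≤ B * h := fun u => by
    rw [abs_mul, abs_of_pos hh]; gcongr; exact hη' _
  have hc : Continuous (deriv η) := hη.continuous_deriv (by norm_num)
  have hi2 : Integrable fun u => K u * (deriv η (w + h * u) * h) :=
    hK.integrable.mul_bdd (by fun_prop) (ae_of_all _ hb)
  have ibp := integral_mul_deriv_eq_deriv_mul_of_integrable (u := K)
    (v := fun u => η (w + h * u)) (u' := deriv K) (v' := fun u => deriv η (w + h * u) * h)
    (fun u _ => (hKd u).hasDerivAt) (fun u _ => hv u) hi2 hi' hi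
  have e : ∫ u, deriv K u * η (w + h * u) = -∫ u, K u * (deriv η (w + h * u) * h) := by
    rw [ibp, neg_neg]
  rw [e, abs_neg]
  calc |∫ u, K u * (deriv η (w + h * u) * h)|
      ≤ ∫ u, |K u * (deriv η (w + h * u) * h)| := abs_integral_le_integral_abs
    _ ≤ ∫ u, |K u| * (B * h) := by
      refine integral_mono hi2.abs (hK.integrable.abs.mul_const _) fun u => ?_
      simp only
      rw [abs_mul]
      gcongr
      exact hb u
    _ = (∫ u, |K u|) * (B * h) := integral_mul_const _ _
    _ ≤ A.CK * (B * h) := by gcongr; exact hK.integral_abs_le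
    _ = _ := by ring

/-- A measurable version of the local Lipschitz function of the derivative of the kernel. -/
lemma KernelConditions.exists_measurable_lipschitz (hK : KernelConditions A K) :
    ∃ φ : ℝ → ℝ, Measurable φ ∧ (∀ u, 0 ≤ φ u) ∧ (∀ u, φ u ≤ A.Mphi) ∧ Integrable φ ∧
      ∫ u, φ u ≤ A.Cphi ∧
      ∀ᵐ u, ∀ d, |d| ≤ A.L → |K (u + d) - K u - deriv K u * d| ≤ φ u * d ^ 2 := by
  obtain ⟨φ, h0, hM, hi, hC, hL⟩ := hK.local_lipschitz
  -- A measurable representative may violate the pointwise bounds, so it is clipped to `[0, Mphi]`;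
  -- the expansion then survives only for almost every `u`.
  set φ₁ := hi.aestronglyMeasurable.mk φ
  have hm : Measurable φ₁ := hi.aestronglyMeasurable.stronglyMeasurable_mk.measurable
  have hae : φ =ᵐ[volume] φ₁ := hi.aestronglyMeasurable.ae_eq_mk
  have hMp : 0 ≤ A.Mphi := (h0 0).trans (hM 0)
  have hae2 : φ =ᵐ[volume] fun u => max 0 (min (φ₁ u) A.Mphi) := by
    filter_upwards [hae] with u hu
    rw [← hu, min_eq_left (hM u), max_eq_right (h0 u)]
  refine ⟨fun u => max 0 (min (φ₁ u) A.Mphi), by fun_prop, fun u => le_max_left _ _,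
    fun u => max_le hMp (min_le_right _ _), hi.congr hae2, ?_, ?_⟩
  · rwa [← integral_congr_ae hae2]
  · filter_upwards [hae2] with u hu d hd
    rw [← hu]
    refine (abs_sub_sub_deriv_mul_le (hK.contDiff.differentiable (by norm_num))
      (C := φ u * |d|) fun t ht => ?_).trans (le_of_eq ?_)
    · have := hL u t (by rw [abs_sub_comm]; exact ht.trans hd)
      rw [abs_sub_comm, abs_sub_comm u] at this
      exact this.trans (mul_le_mul_of_nonneg_left ht (h0 u))
    · rw [mul_assoc, ← pow_two, sq_abs]

end Kernel

/-! ### Composite constants and a common class of weights for `K`, `K'` and `φ`. -/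

/-- A common sup bound for the kernel, its derivative, and the local Lipschitz function. -/
def Constants.kernelSup (A : Constants) : ℝ := |A.MK| + |A.MdK| + |A.Mphi| + 1

/-- A common bound for the integrals of the kernel, its derivative, and the local Lipschitz
function. -/
def Constants.kernelMass (A : Constants) : ℝ := |A.CK| + |A.CdK| + |A.Cphi|

/-- A common bound for `1` and the differences of the covariates. -/
def Constants.diameter (A : Constants) : ℝ := 2 * (|A.MX| + 1)

/-- The variance factor of the kernel averages. -/
def Constants.varianceFactor (A : Constants) : ℝ :=
  A.diameter ^ 2 * (|A.B1| * A.kernelSup * A.kernelMass)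

/-- The factor in front of the deviation terms of kernel averages. -/
def Constants.noiseFactor (A : Constants) (s : ℝ) : ℝ :=
  2 + 2 * A.varianceFactor + 7 * (s * (A.kernelSup * A.diameter))

lemma Constants.kernelSup_pos (A : Constants) : 0 < A.kernelSup := by
  unfold Constants.kernelSup; positivity

lemma Constants.kernelMass_nonneg (A : Constants) : 0 ≤ A.kernelMass := by
  unfold Constants.kernelMass; positivity

lemma Constants.one_le_diameter (A : Constants) : 1 ≤ A.diameter := by
  unfold Constants.diameter; linarith [abs_nonneg A.MX]

lemma Constants.varianceFactor_nonneg (A : Constants) : 0 ≤ A.varianceFactor := by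
  have h1 := A.kernelSup_pos
  have h2 := A.kernelMass_nonneg
  unfold Constants.varianceFactor; positivity

/-- A weight function that is controlled by the constants of the kernel conditions. -/
structure IsKernelWeight (A : Constants) (k : ℝ → ℝ) : Prop where
  measurable : Measurable k
  bounded : ∀ u, |k u| ≤ A.kernelSup
  integrable : Integrable k
  integral_le : ∫ u, |k u| ≤ A.kernelMass

lemma KernelConditions.isKernelWeight {A : Constants} {K : ℝ → ℝ} (hK : KernelConditions A K) :
    IsKernelWeight A K := by
  refine ⟨hK.contDiff.continuous.measurable, fun u => ?_, hK.integrable, ?_⟩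
  · have := hK.bounded u
    unfold Constants.kernelSup
    linarith [le_abs_self A.MK, abs_nonneg A.MdK, abs_nonneg A.Mphi]
  · have := hK.integral_abs_le
    unfold Constants.kernelMass
    linarith [le_abs_self A.CK, abs_nonneg A.CdK, abs_nonneg A.Cphi]

lemma KernelConditions.isKernelWeight_deriv {A : Constants} {K : ℝ → ℝ}
    (hK : KernelConditions A K) : IsKernelWeight A (deriv K) := by
  refine ⟨measurable_deriv K, fun u => ?_, hK.deriv_integrable, ?_⟩
  · have := hK.deriv_bounded u
    unfold Constants.kernelSup
    linarith [le_abs_self A.MdK, abs_nonneg A.MK, abs_nonneg A.Mphi]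
  · have := hK.integral_abs_deriv_le
    unfold Constants.kernelMass
    linarith [le_abs_self A.CdK, abs_nonneg A.CK, abs_nonneg A.Cphi]

/-! ### Variances and means of the three kinds of summands. -/

section Population

variable {A : Constants} {p : ℕ} {P : Measure (ℝ × (Fin p → ℝ))} [IsProbabilityMeasure P]
  {β x : Fin p → ℝ} {f g : ℝ → ℝ} {Y : ℝ × (Fin p → ℝ) → ℝ} {s h : ℝ} {K k : ℝ → ℝ}

-- The box is closed and has full measure, hence contains the support.
omit [IsProbabilityMeasure P] in
lemma abs_le_of_mem_support (hb : ∀ᵐ z ∂P, ∀ j, |z.2 j| ≤ A.MX)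
    (hx : x ∈ (P.map Prod.snd).support) (j : Fin p) : |x j| ≤ A.MX := by
  have hc : IsClosed {y : Fin p → ℝ | ∀ j, |y j| ≤ A.MX} := by
    simp only [Set.ofPred_forall]
    exact isClosed_iInter fun j => isClosed_le (by fun_prop) continuous_const
  have h1 : {y : Fin p → ℝ | ∀ j, |y j| ≤ A.MX} ∈ ae (P.map Prod.snd) :=
    (ae_map_iff measurable_snd.aemeasurable hc.measurableSet).2 hb
  exact Measure.support_subset_of_isClosed hc h1 hx j

@[fun_prop]
lemma measurable_index (β : Fin p → ℝ) :
    Measurable fun z : ℝ × (Fin p → ℝ) => β ⬝ᵥ z.2 := by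
  unfold dotProduct
  fun_prop

/-- Otherwise the covariates, hence the index, vanish almost surely, which is incompatible with a
Lebesgue density. Positivity permits division by `2 * MX` when bounding `a / h`. -/
lemma covariate_bound_pos (hd : IsDensityOf P (fun z => β ⬝ᵥ z.2) f)
    (hb : ∀ᵐ z ∂P, ∀ j, |z.2 j| ≤ A.MX) : 0 < A.MX := by
  by_contra! hM
  have h1 : ∀ᵐ z ∂P, β ⬝ᵥ z.2 = 0 := by
    filter_upwards [hb] with z hz
    refine Finset.sum_eq_zero fun j _ => ?_
    rw [abs_eq_zero.1 (le_antisymm ((hz j).trans hM) (abs_nonneg _)), mul_zero]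
  have h2 : ∀ᵐ u ∂(P.map fun z => β ⬝ᵥ z.2), u = 0 :=
    (ae_map_iff (measurable_index β).aemeasurable (measurableSet_singleton 0)).2 h1
  have h3 : ∀ᵐ u ∂(P.map fun z => β ⬝ᵥ z.2), u ≠ 0 := by
    rw [hd.map_eq]
    exact (withDensity_absolutelyContinuous volume _).ae_le (Measure.ae_ne volume 0)
  have : IsProbabilityMeasure (P.map fun z => β ⬝ᵥ z.2) :=
    Measure.isProbabilityMeasure_map (measurable_index β).aemeasurable
  obtain ⟨u, hu1, hu2⟩ := (h2.and h3).exists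
  exact hu2 hu1

-- The index has an absolutely continuous law, so it avoids the null set on which the expansion of
-- the kernel may fail.
omit [IsProbabilityMeasure P] in
lemma IsDensityOf.ae_index (hd : IsDensityOf P (fun z => β ⬝ᵥ z.2) f) (hh : 0 < h) (w : ℝ)
    {q : ℝ → Prop} (hq : ∀ᵐ u, q u) : ∀ᵐ z ∂P, q ((β ⬝ᵥ z.2 - w) / h) := by
  have h1 : ∀ᵐ u, q ((u - w) / h) := by
    rw [ae_iff] at hq ⊢
    have e : {u | ¬ q ((u - w) / h)} = (fun u => (u + -w) / h) ⁻¹' {u | ¬ q u} := by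
      ext u; simp [sub_eq_add_neg]
    rw [e, show (fun u => (u + -w) / h) = (fun u => u * h⁻¹) ∘ (fun u => u + -w) by
      funext u; simp [div_eq_mul_inv], Set.preimage_comp, measure_preimage_add_right,
      Real.volume_preimage_mul_right (inv_ne_zero hh.ne'), hq, mul_zero]
  refine ae_of_ae_map (measurable_index β).aemeasurable (p := fun u => q ((u - w) / h)) ?_
  rw [hd.map_eq]
  exact (withDensity_absolutelyContinuous volume _).ae_le h1

/-- Sub-Gaussian and variance bounds for the summands of a kernel average. -/
lemma ResponseConditions.summand_bounds (hY : ResponseConditions A P Y Prod.snd β f g)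
    (hd : IsDensityOf P (fun z => β ⬝ᵥ z.2) f) (hYs : SquareExpBound P Y s)
    (hs : 0 < s) (hk : IsKernelWeight A k) (hh : 0 < h) (w : ℝ) {ξ : ℝ × (Fin p → ℝ) → ℝ}
    (hξ : Measurable ξ)
    (hle : ∀ᵐ z ∂P, |ξ z| ≤ A.diameter * |Y z * k ((β ⬝ᵥ z.2 - w) / h)|) :
    SquareExpBound P ξ (s * (A.kernelSup * A.diameter)) ∧
      ∫ z, ξ z ^ 2 ∂P ≤ A.varianceFactor * h := by
  have hS := A.kernelSup_pos
  have hD : 0 < A.diameter := lt_of_lt_of_le one_pos A.one_le_diameter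
  have h1 : SquareExpBound P ξ (s * (A.kernelSup * A.diameter)) := by
    refine hYs.of_le hξ (by positivity) hs ?_
    filter_upwards [hle] with z hz
    refine hz.trans ?_
    rw [abs_mul]
    calc A.diameter * (|Y z| * |k ((β ⬝ᵥ z.2 - w) / h)|) ≤
          A.diameter * (|Y z| * A.kernelSup) := by gcongr; exact hk.bounded _
      _ = _ := by ring
  refine ⟨h1, ?_⟩
  obtain ⟨g₂, hr, hg⟩ := hY.second_moment
  -- This makes `k²` an integrable bounded weight, so the rescaling gives the second moment its
  -- factor `h`.
  have hk2 : ∀ u, |k u ^ 2| ≤ A.kernelSup * |k u| := fun u => by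
    rw [abs_pow, pow_two]; gcongr; exact hk.bounded u
  have hk2m : Measurable fun u => k u ^ 2 := hk.measurable.pow_const 2
  have hk2i : Integrable fun u => k u ^ 2 :=
    (hk.integrable.abs.const_mul A.kernelSup).mono' hk2m.aestronglyMeasurable (ae_of_all _ hk2)
  have hB : ∀ u, |k u ^ 2| ≤ A.kernelSup ^ 2 := fun u => by
    rw [abs_pow]; gcongr; exact hk.bounded u
  have hb := hr.abs_integral_mul_kernel_le hd (measurable_index β) hk2m hB hk2i
    (C := |A.B1|) (fun u => (hg u).trans (le_abs_self _)) w hh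
  have hint := (hr.integral_mul_kernel hd (measurable_index β) hk2m hB w hh).1
  have hmass : ∫ u, |k u ^ 2| ≤ A.kernelSup * A.kernelMass := by
    refine (integral_mono hk2i.abs (hk.integrable.abs.const_mul _) hk2).trans ?_
    rw [integral_const_mul]
    gcongr
    exact hk.integral_le
  have hpos : 0 < s * (A.kernelSup * A.diameter) := by positivity
  calc ∫ z, ξ z ^ 2 ∂P ≤
        ∫ z, A.diameter ^ 2 * (Y z ^ 2 * k ((β ⬝ᵥ z.2 - w) / h) ^ 2) ∂P := by
        refine integral_mono_ae (h1.integrable_sq hξ hpos) (hint.const_mul _) ?_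
        filter_upwards [hle] with z hz
        have h3 := pow_le_pow_left₀ (abs_nonneg _) hz 2
        rw [sq_abs, mul_pow, sq_abs, mul_pow] at h3
        exact h3
    _ = A.diameter ^ 2 * ∫ z, Y z ^ 2 * k ((β ⬝ᵥ z.2 - w) / h) ^ 2 ∂P :=
        integral_const_mul _ _
    _ ≤ A.diameter ^ 2 * (|A.B1| * (A.kernelSup * A.kernelMass) * h) := by
        gcongr
        refine (le_abs_self _).trans (hb.trans ?_)
        gcongr
    _ = _ := by unfold Constants.varianceFactor; ring

lemma ResponseConditions.mean_kernel_le (hY : ResponseConditions A P Y Prod.snd β f g)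
    (hd : IsDensityOf P (fun z => β ⬝ᵥ z.2) f) (hK : KernelConditions A K) (hh : 0 < h)
    (w : ℝ) :
    |(∫ z, Y z * K ((β ⬝ᵥ z.2 - w) / h) ∂P) / h - g w * f w| ≤ A.B2 * A.RK * h ^ 2 := by
  obtain ⟨-, h2, h3⟩ := hY.regression.integral_mul_kernel hd (measurable_index β)
    hK.isKernelWeight.measurable hK.bounded w hh
  rw [h3, mul_div_cancel_left₀ _ hh.ne']
  exact hK.bias_le (l := fun w => g w * f w) hY.contDiff hY.deriv_two_bounded w hh h2

/-- One factor `h` comes from the change of variables, the other from integration by parts. -/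
lemma abs_mean_deriv_kernel_le {r : ℝ → ℝ} {V : ℝ × (Fin p → ℝ) → ℝ} {B : ℝ}
    (hr : IsRegressionFunction P V (fun z => β ⬝ᵥ z.2) r)
    (hd : IsDensityOf P (fun z => β ⬝ᵥ z.2) f) (hK : KernelConditions A K) (hh : 0 < h)
    (w : ℝ) (hc : ContDiff ℝ 1 fun w => r w * f w) (hB : ∀ w, |deriv (fun w => r w * f w) w| ≤ B) :
    |∫ z, V z * deriv K ((β ⬝ᵥ z.2 - w) / h) ∂P| ≤ A.CK * B * h ^ 2 := by
  obtain ⟨-, h2, -⟩ := hr.integral_mul_kernel hd (measurable_index β)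
    hK.isKernelWeight.measurable hK.bounded w hh
  obtain ⟨-, h2', h3⟩ := hr.integral_mul_kernel hd (measurable_index β)
    hK.isKernelWeight_deriv.measurable hK.deriv_bounded w hh
  rw [h3, abs_mul, abs_of_pos hh]
  have := hK.integral_deriv_mul_le hc hB w hh h2 h2'
  nlinarith

lemma ResponseConditions.mean_gradient_le (hY : ResponseConditions A P Y Prod.snd β f g)
    (hd : IsDensityOf P (fun z => β ⬝ᵥ z.2) f) (hK : KernelConditions A K) (hh : 0 < h)
    (w : ℝ) (j : Fin p) {y : ℝ} (hy : |y| ≤ A.MX) :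
    |∫ z, Y z * deriv K ((β ⬝ᵥ z.2 - w) / h) * (z.2 j - y) ∂P| ≤
      |A.CK| * (|A.B1star| + |A.MX| * |A.B2star|) * h ^ 2 := by
  obtain ⟨r, hr, hrc, hrB⟩ := hY.weighted j
  have h1 := abs_mean_deriv_kernel_le hr hd hK hh w hrc hrB
  have h2 := abs_mean_deriv_kernel_le hY.regression hd hK hh w
    (hY.contDiff.of_le (by norm_num)) hY.deriv_bounded
  have i1 := (hr.integral_mul_kernel hd (measurable_index β)
    hK.isKernelWeight_deriv.measurable hK.deriv_bounded w hh).1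
  have i2 := (hY.regression.integral_mul_kernel hd (measurable_index β)
    hK.isKernelWeight_deriv.measurable hK.deriv_bounded w hh).1
  have e : ∫ z, Y z * deriv K ((β ⬝ᵥ z.2 - w) / h) * (z.2 j - y) ∂P =
      (∫ z, Y z * z.2 j * deriv K ((β ⬝ᵥ z.2 - w) / h) ∂P) -
        y * ∫ z, Y z * deriv K ((β ⬝ᵥ z.2 - w) / h) ∂P := by
    rw [← integral_const_mul, ← integral_sub i1 (i2.const_mul y)]
    congr 1; funext z; ring
  rw [e]
  refine (abs_sub _ _).trans ?_
  rw [abs_mul]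
  have h3 : A.CK * A.B1star ≤ |A.CK| * |A.B1star| := by
    rw [← abs_mul]; exact le_abs_self _
  have h4 : A.CK * A.B2star ≤ |A.CK| * |A.B2star| := by
    rw [← abs_mul]; exact le_abs_self _
  calc _ ≤ |A.CK| * |A.B1star| * h ^ 2 + |A.MX| * (|A.CK| * |A.B2star| * h ^ 2) := by
        refine add_le_add (h1.trans (by gcongr)) (mul_le_mul (hy.trans (le_abs_self _))
          (h2.trans (by gcongr)) (abs_nonneg _) (abs_nonneg _))
    _ = _ := by ring

/-- Since `|Y| ≤ (Y² + 1) / 2`, the second moment conditions on `Y` and on the constant response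
suffice; none on the conditional mean of `|Y|` is needed. -/
lemma mean_abs_weight_le (hY : ResponseConditions A P Y Prod.snd β f g)
    (hU : ResponseConditions A P (fun _ => 1) Prod.snd β f (fun _ => 1))
    (hd : IsDensityOf P (fun z => β ⬝ᵥ z.2) f) (hYm : Measurable Y)
    (hk : IsKernelWeight A k) (hk0 : ∀ u, 0 ≤ k u) (hh : 0 < h) (w : ℝ) :
    ∫ z, |Y z| * k ((β ⬝ᵥ z.2 - w) / h) ∂P ≤ |A.B1| * A.kernelMass * h := by
  have aux : ∀ {V : ℝ × (Fin p → ℝ) → ℝ} {g : ℝ → ℝ},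
      ResponseConditions A P V Prod.snd β f g →
      Integrable (fun z => V z ^ 2 * k ((β ⬝ᵥ z.2 - w) / h)) P ∧
      ∫ z, V z ^ 2 * k ((β ⬝ᵥ z.2 - w) / h) ∂P ≤ |A.B1| * A.kernelMass * h := by
    intro V g hV
    obtain ⟨g₂, hr, hg⟩ := hV.second_moment
    refine ⟨(hr.integral_mul_kernel hd (measurable_index β) hk.measurable hk.bounded w hh).1, ?_⟩
    refine (le_abs_self _).trans ((hr.abs_integral_mul_kernel_le hd (measurable_index β)
      hk.measurable hk.bounded hk.integrable (C := |A.B1|)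
      (fun u => (hg u).trans (le_abs_self _)) w hh).trans ?_)
    gcongr
    exact hk.integral_le
  obtain ⟨i1, b1⟩ := aux hY
  obtain ⟨i2, b2⟩ := aux hU
  have hle : ∀ z : ℝ × (Fin p → ℝ), |Y z| * k ((β ⬝ᵥ z.2 - w) / h) ≤
      (Y z ^ 2 * k ((β ⬝ᵥ z.2 - w) / h) + 1 ^ 2 * k ((β ⬝ᵥ z.2 - w) / h)) / 2 := by
    intro z
    have h1 : |Y z| ≤ (Y z ^ 2 + 1) / 2 := by nlinarith [sq_nonneg (|Y z| - 1), sq_abs (Y z)]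
    have := mul_le_mul_of_nonneg_right h1 (hk0 ((β ⬝ᵥ z.2 - w) / h))
    linarith
  have hkm := hk.measurable
  have i3 : Integrable (fun z => (Y z ^ 2 * k ((β ⬝ᵥ z.2 - w) / h) +
      1 ^ 2 * k ((β ⬝ᵥ z.2 - w) / h)) / 2) P := (i1.add i2).div_const 2
  have i4 : Integrable (fun z => |Y z| * k ((β ⬝ᵥ z.2 - w) / h)) P := by
    refine i3.mono' (by fun_prop) (ae_of_all _ fun z => ?_)
    rw [Real.norm_eq_abs, abs_mul, abs_abs, abs_of_nonneg (hk0 _)]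
    exact hle z
  refine (integral_mono i4 i3 hle).trans ?_
  rw [integral_div, integral_add i1 i2]
  linarith

end Population

/-! ### Comparison of the error terms with the rate. -/

/-- The rate `(t + 1) / √(n h) + t² √(log n) / (n h) + bₙ`. -/
def baseRate (n p : ℕ) (h a t : ℝ) : ℝ :=
  (t + 1) / √(n * h) + t ^ 2 * √(Real.log n) / (n * h) + bRate n p h a

lemma epsRate_self (C : ℝ) (n p : ℕ) (h a t : ℝ) :
    epsRate C C C n p h a t = C * baseRate n p h a t := by
  unfold epsRate baseRate; ring

section Rates

variable {n p : ℕ} {h a t : ℝ}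

lemma log_mul_natCast (hn : 2 ≤ n) (hp : 1 ≤ p) :
    Real.log (n * p) = Real.log n + Real.log p :=
  Real.log_mul (by positivity) (by positivity)

lemma log_natCast_le_log_mul (hn : 2 ≤ n) (hp : 1 ≤ p) : Real.log n ≤ Real.log (n * p) := by
  rw [log_mul_natCast hn hp]
  linarith [Real.log_natCast_nonneg p]

lemma log_mul_div_nonneg (hn : 2 ≤ n) (hp : 1 ≤ p) (hh : 0 < h) :
    0 ≤ Real.log (n * p) / (n * h) := by
  have := log_natCast_le_log_mul hn hp
  have := log_natCast_ge hn
  have : 0 ≤ Real.log (n * p) := by linarith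
  positivity

lemma bRate_nonneg (hn : 2 ≤ n) (hp : 1 ≤ p) (hh : 0 < h) (ha : 0 ≤ a) :
    0 ≤ bRate n p h a := by
  have := log_mul_div_nonneg hn hp hh
  unfold bRate; positivity

lemma baseRate_nonneg (hn : 2 ≤ n) (hp : 1 ≤ p) (hh : 0 < h) (ha : 0 ≤ a) (ht : 0 ≤ t) :
    0 ≤ baseRate n p h a t := by
  have := bRate_nonneg hn hp hh ha
  unfold baseRate; positivity

lemma sum_terms_eq_baseRate :
    t / √(n * h) + 1 / √(n * h) + t ^ 2 * √(Real.log n) / (n * h)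
      + Real.log (n * p) / (n * h) + h ^ 2 + a + a ^ 2 / h ^ 2 = baseRate n p h a t := by
  unfold baseRate bRate; ring

lemma deviation_le_baseRate (hn : 2 ≤ n) (hp : 1 ≤ p) (hh : 0 < h) (ha : 0 ≤ a) :
    deviation n h t ≤ baseRate n p h a t := by
  rw [← sum_terms_eq_baseRate, deviation]
  have h1 : Real.log n / (n * h) ≤ Real.log (n * p) / (n * h) := by
    exact div_le_div_of_nonneg_right (log_natCast_le_log_mul hn hp) (by positivity)
  have h2 : 0 ≤ 1 / √(n * h) := by positivity
  have h3 : 0 ≤ a ^ 2 / h ^ 2 := by positivity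
  nlinarith [sq_nonneg h]

/-- With `√(t² + log p) ≤ t + √(log p)`, the linear term yields `κ / √(n h)`. In the quadratic term,
`log p √(log n)` is split as `√(log p)`, absorbed by `κ`, times `√(log p) √(log n) ≤ log (n p)`. -/
lemma mul_deviation_le_baseRate (hn : 2 ≤ n) (hp : 1 ≤ p) (hh : 0 < h) (ha : 0 ≤ a)
    (ht : 0 ≤ t) {α₀ κ : ℝ} (hα : a / h ≤ α₀) (hκ : a / h * √(Real.log p) ≤ κ) :
    a / h * deviation n h √(t ^ 2 + Real.log p) ≤ (α₀ + κ) * baseRate n p h a t := by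
  have hlp := Real.log_natCast_nonneg p
  have hln := log_natCast_ge hn
  have hα1 : 0 ≤ a / h := by positivity
  have hα0 : 0 ≤ α₀ := hα1.trans hα
  have hκ0 : 0 ≤ κ := le_trans (by positivity) hκ
  set α := a / h with hαdef
  set τ := √(t ^ 2 + Real.log p) with hτ
  have hτ1 : τ ≤ t + √(Real.log p) := by
    rw [hτ, Real.sqrt_le_left (by positivity)]
    nlinarith [Real.sq_sqrt hlp, mul_nonneg ht (Real.sqrt_nonneg (Real.log p))]
  have hτ2 : τ ^ 2 = t ^ 2 + Real.log p := Real.sq_sqrt (by positivity)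
  have hlog := log_mul_natCast hn hp
  have b1 : α * τ ≤ α₀ * t + κ := by nlinarith [mul_le_mul_of_nonneg_left hτ1 hα1]
  have hss : √(Real.log p) * √(Real.log n) ≤ Real.log (n * p) := by
    nlinarith [Real.sq_sqrt hlp, Real.sq_sqrt (by linarith : 0 ≤ Real.log n),
      sq_nonneg (√(Real.log p) - √(Real.log n))]
  have b2 : α * (τ ^ 2 * √(Real.log n)) ≤
      α₀ * (t ^ 2 * √(Real.log n)) + κ * Real.log (n * p) := by
    have e : α * (τ ^ 2 * √(Real.log n)) = α * (t ^ 2 * √(Real.log n)) +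
        (α * √(Real.log p)) * (√(Real.log p) * √(Real.log n)) := by
      rw [hτ2]
      nth_rw 1 [← Real.mul_self_sqrt hlp]
      ring
    rw [e]
    gcongr
  have b3 : α * Real.log n ≤ α₀ * Real.log (n * p) := by
    have := log_natCast_le_log_mul hn hp
    exact mul_le_mul hα this (by linarith) hα0
  have e1 : α * deviation n h τ = (α * τ) / √(n * h) +
      (α * (τ ^ 2 * √(Real.log n))) / (n * h) + (α * Real.log n) / (n * h) := by
    unfold deviation; ring
  have hN : 0 < n * h := by positivity
  calc α * deviation n h τ ≤ (α₀ * t + κ) / √(n * h) +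
        (α₀ * (t ^ 2 * √(Real.log n)) + κ * Real.log (n * p)) / (n * h) +
        (α₀ * Real.log (n * p)) / (n * h) := by
        rw [e1]; gcongr
    _ = α₀ * (t / √(n * h)) + κ * (1 / √(n * h)) + α₀ * (t ^ 2 * √(Real.log n) / (n * h)) +
        (α₀ + κ) * (Real.log (n * p) / (n * h)) := by ring
    _ ≤ (α₀ + κ) * (t / √(n * h) + 1 / √(n * h) + t ^ 2 * √(Real.log n) / (n * h)
      + Real.log (n * p) / (n * h) + h ^ 2 + a + a ^ 2 / h ^ 2) := by
        have c1 : 0 ≤ t / √(n * h) := by positivity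
        have c2 : 0 ≤ 1 / √(n * h) := by positivity
        have c3 : 0 ≤ t ^ 2 * √(Real.log n) / (n * h) := by positivity
        have c4 : 0 ≤ (α₀ + κ) * (h ^ 2 + a + a ^ 2 / h ^ 2) := by positivity
        have c5 := mul_nonneg hκ0 c1
        have c6 := mul_nonneg hα0 c2
        have c7 := mul_nonneg hκ0 c3
        linarith
    _ = _ := by rw [sum_terms_eq_baseRate]

end Rates

/-! ### Deterministic expansion in the index. -/

section Decomposition

variable {n p : ℕ} {h : ℝ}

/-- Second-order expansion of the kernel average in the index. -/
lemma abs_lHat_sub_le {K : ℝ → ℝ} {z : Fin n → ℝ} {xs : Fin n → Fin p → ℝ}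
    {b β x : Fin p → ℝ} {a L M T₁ T₂ T₃ l : ℝ} {φ : ℝ → ℝ} (hh : 0 < h)
    (hb : ∑ j, |b j - β j| ≤ a) (hxs : ∀ i j, |xs i j| ≤ M) (hx : ∀ j, |x j| ≤ M)
    (hM : 0 ≤ M) (hL : 2 * M * (a / h) ≤ L)
    (hφ0 : ∀ u, 0 ≤ φ u)
    (hφ : ∀ i, ∀ d, |d| ≤ L → |K ((β ⬝ᵥ xs i - β ⬝ᵥ x) / h + d) - K ((β ⬝ᵥ xs i - β ⬝ᵥ x) / h) -
      deriv K ((β ⬝ᵥ xs i - β ⬝ᵥ x) / h) * d| ≤ φ ((β ⬝ᵥ xs i - β ⬝ᵥ x) / h) * d ^ 2)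
    (h1 : |1 / (n * h) * ∑ i, z i * K ((β ⬝ᵥ xs i - β ⬝ᵥ x) / h) - l| ≤ T₁)
    (h2 : ∀ j, |1 / (n * h) *
      ∑ i, z i * deriv K ((β ⬝ᵥ xs i - β ⬝ᵥ x) / h) * (xs i j - x j)| ≤ T₂)
    (hT₂ : 0 ≤ T₂)
    (h3 : 1 / (n * h) * ∑ i, |z i| * φ ((β ⬝ᵥ xs i - β ⬝ᵥ x) / h) ≤ T₃) :
    |lHat K h z xs b x - l| ≤ T₁ + a / h * T₂ + (2 * M * (a / h)) ^ 2 * T₃ := by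
  set u : Fin n → ℝ := fun i => (β ⬝ᵥ xs i - β ⬝ᵥ x) / h with hu
  set d : Fin n → ℝ := fun i => ∑ j, (b j - β j) / h * (xs i j - x j) with hd
  have hud : ∀ i, (b ⬝ᵥ xs i - b ⬝ᵥ x) / h = u i + d i := by
    intro i
    simp only [hu, hd, dotProduct]
    rw [← Finset.sum_sub_distrib, ← Finset.sum_sub_distrib, Finset.sum_div, Finset.sum_div,
      ← Finset.sum_add_distrib]
    refine Finset.sum_congr rfl fun j _ => ?_
    ring
  have hdL : ∀ i, |d i| ≤ 2 * M * (a / h) := by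
    intro i
    calc |d i| ≤ ∑ j, |(b j - β j) / h * (xs i j - x j)| := Finset.abs_sum_le_sum_abs _ _
      _ ≤ ∑ j, |b j - β j| / h * (2 * M) := by
        refine Finset.sum_le_sum fun j _ => ?_
        rw [abs_mul, abs_div, abs_of_pos hh]
        gcongr
        exact (abs_sub _ _).trans (by linarith [hxs i j, hx j])
      _ = (∑ j, |b j - β j|) / h * (2 * M) := by rw [← Finset.sum_mul, Finset.sum_div]
      _ ≤ a / h * (2 * M) := by gcongr
      _ = _ := by ring
  have hN : 0 ≤ 1 / (n * h) := by positivity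
  set R : Fin n → ℝ := fun i => K (u i + d i) - K (u i) - deriv K (u i) * d i with hR
  have e : lHat K h z xs b x - l = (1 / (n * h) * ∑ i, z i * K (u i) - l) +
      (∑ j, (b j - β j) / h * (1 / (n * h) * ∑ i, z i * deriv K (u i) * (xs i j - x j))) +
      1 / (n * h) * ∑ i, z i * R i := by
    -- Exchanging the sums isolates `b - β` from averages that do not involve `b`, which is what
    -- permits Hölder's inequality uniformly in `b`.
    have e1 : ∑ j, (b j - β j) / h * (1 / (n * h) * ∑ i, z i * deriv K (u i) * (xs i j - x j)) =
        1 / (n * h) * ∑ i, z i * deriv K (u i) * d i := by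
      simp only [hd, Finset.mul_sum]
      rw [Finset.sum_comm]
      refine Finset.sum_congr rfl fun i _ => Finset.sum_congr rfl fun j _ => ?_
      ring
    have e2 : ∑ i, z i * K (u i + d i) =
        ∑ i, z i * K (u i) + ∑ i, z i * deriv K (u i) * d i + ∑ i, z i * R i := by
      rw [← Finset.sum_add_distrib, ← Finset.sum_add_distrib]
      refine Finset.sum_congr rfl fun i _ => ?_
      simp only [hR]; ring
    rw [e1, lHat]
    simp only [hud]
    rw [e2]
    ring
  have hB : |∑ j, (b j - β j) / h *
      (1 / (n * h) * ∑ i, z i * deriv K (u i) * (xs i j - x j))| ≤ a / h * T₂ := by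
    refine (Finset.abs_sum_le_sum_abs _ _).trans ?_
    calc _ ≤ ∑ j, |b j - β j| / h * T₂ := by
          refine Finset.sum_le_sum fun j _ => ?_
          rw [abs_mul, abs_div, abs_of_pos hh]
          exact mul_le_mul_of_nonneg_left (h2 j) (by positivity)
      _ = (∑ j, |b j - β j|) / h * T₂ := by rw [← Finset.sum_mul, Finset.sum_div]
      _ ≤ _ := by gcongr
  have hC : |1 / (n * h) * ∑ i, z i * R i| ≤ (2 * M * (a / h)) ^ 2 * T₃ := by
    rw [abs_mul, abs_of_nonneg hN]
    have hsum : |∑ i, z i * R i| ≤ (2 * M * (a / h)) ^ 2 * ∑ i, |z i| * φ (u i) := by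
      refine (Finset.abs_sum_le_sum_abs _ _).trans ?_
      rw [Finset.mul_sum]
      refine Finset.sum_le_sum fun i _ => ?_
      rw [abs_mul]
      have hRi := hφ i (d i) ((hdL i).trans hL)
      have hd2 : d i ^ 2 ≤ (2 * M * (a / h)) ^ 2 := by
        rw [← sq_abs]; exact pow_le_pow_left₀ (abs_nonneg _) (hdL i) 2
      calc |z i| * |R i| ≤ |z i| * (φ (u i) * (2 * M * (a / h)) ^ 2) := by
            gcongr
            exact hRi.trans (mul_le_mul_of_nonneg_left hd2 (hφ0 _))
        _ = _ := by ring
    calc 1 / (n * h) * |∑ i, z i * R i| ≤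
          1 / (n * h) * ((2 * M * (a / h)) ^ 2 * ∑ i, |z i| * φ (u i)) := by gcongr
      _ = (2 * M * (a / h)) ^ 2 * (1 / (n * h) * ∑ i, |z i| * φ (u i)) := by ring
      _ ≤ _ := by gcongr
  rw [e]
  exact (abs_add_three _ _ _).trans (by gcongr)

end Decomposition

/-! ### Probability bound for a linear kernel average. -/

/-- Only subadditivity is used, so neither set has to be measurable. -/
lemma one_sub_le_measureReal {Ω : Type*} [MeasurableSpace Ω] {μ : Measure Ω}
    [IsProbabilityMeasure μ] {S B : Set Ω} {r : ℝ} (h : ∀ᵐ ω ∂μ, ω ∉ B → ω ∈ S)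
    (hB : μ.real B ≤ r) : 1 - r ≤ μ.real S := by
  have h1 : μ (S ∪ B) = 1 := by
    rw [← measure_univ (μ := μ)]
    refine measure_congr (eventuallyEq_univ.2 ?_)
    filter_upwards [h] with ω hω
    by_cases hb : ω ∈ B
    · exact Or.inr hb
    · exact Or.inl (hω hb)
  have h2 : μ.real (S ∪ B) = 1 := by rw [measureReal_def, h1]; rfl
  linarith [measureReal_union_le (μ := μ) S B]

/-- The factor in the rate of the linear kernel averages. -/
def Constants.rateFactor (A : Constants) (κ s : ℝ) : ℝ :=
  A.noiseFactor s * (1 + (|A.L| / (2 * |A.MX|) + |κ|) + A.L ^ 2) + |A.B2 * A.RK|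
    + |A.CK| * (|A.B1star| + |A.MX| * |A.B2star|)
    + (2 * A.MX) ^ 2 * (|A.B1| * A.kernelMass) + 1

lemma Constants.noiseFactor_pos (A : Constants) {s : ℝ} (hs : 0 < s) : 0 < A.noiseFactor s := by
  have h1 := A.kernelSup_pos
  have h2 := A.varianceFactor_nonneg
  have h3 := A.one_le_diameter
  unfold Constants.noiseFactor
  positivity

lemma Constants.rateFactor_pos (A : Constants) (κ : ℝ) {s : ℝ} (hs : 0 < s) :
    0 < A.rateFactor κ s := by
  have h1 := A.noiseFactor_pos hs
  have h2 := A.kernelMass_nonneg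
  unfold Constants.rateFactor
  positivity

/-- Each piece meets its own term of the rate: the gradient mean gives `a / h * h = a`, the
quadratic mean gives `a² / h²`, and the fluctuation of the quadratic term is damped by `(2 * MX * (a
/ h))² ≤ L²`. -/
lemma expansion_le_rateFactor_mul {A : Constants} {n p : ℕ} {h a t κ s : ℝ} (hn : 2 ≤ n)
    (hp : 1 ≤ p) (hh : 0 < h) (ha : 0 ≤ a) (ht : 0 ≤ t) (hMX : 0 < A.MX) (hL : 0 < A.L)
    (haL : 2 * A.MX * (a / h) ≤ A.L) (hκ : a / h * √(Real.log p) ≤ κ) (hs : 0 < s) :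
    A.noiseFactor s * deviation n h t + |A.B2 * A.RK| * h ^ 2 +
      a / h * (A.noiseFactor s * deviation n h √(t ^ 2 + Real.log p) +
        |A.CK| * (|A.B1star| + |A.MX| * |A.B2star|) * h) +
      (2 * A.MX * (a / h)) ^ 2 *
        (A.noiseFactor s * deviation n h t + |A.B1| * A.kernelMass) ≤
      A.rateFactor κ s * baseRate n p h a t := by
  have hQp : 0 < A.noiseFactor s := A.noiseFactor_pos hs
  have hDt : 0 ≤ deviation n h t := by
    have := log_natCast_ge hn
    unfold deviation; positivity
  have hc₂0 : 0 ≤ |A.CK| * (|A.B1star| + |A.MX| * |A.B2star|) := by positivity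
  have hc₃0 : 0 ≤ |A.B1| * A.kernelMass := mul_nonneg (abs_nonneg _) A.kernelMass_nonneg
  have hfac : ∀ E, A.rateFactor κ s * E =
      A.noiseFactor s * E + A.noiseFactor s * ((|A.L| / (2 * |A.MX|) + |κ|) * E) +
      A.L ^ 2 * (A.noiseFactor s * E) + |A.B2 * A.RK| * E +
      |A.CK| * (|A.B1star| + |A.MX| * |A.B2star|) * E +
      (2 * A.MX) ^ 2 * (|A.B1| * A.kernelMass) * E + E := fun E => by
    unfold Constants.rateFactor
    ring
  generalize A.noiseFactor s = Q at *
  generalize |A.CK| * (|A.B1star| + |A.MX| * |A.B2star|) = c₂ at *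
  generalize |A.B1| * A.kernelMass = c₃ at *
  set τ := √(t ^ 2 + Real.log p) with hτ
  set E := baseRate n p h a t with hE
  have hE0 : 0 ≤ E := baseRate_nonneg hn hp hh ha ht
  have d1 : deviation n h t ≤ E := deviation_le_baseRate hn hp hh ha
  have d2 : a / h * deviation n h τ ≤ (|A.L| / (2 * |A.MX|) + |κ|) * E := by
    refine mul_deviation_le_baseRate hn hp hh ha ht ?_ (hκ.trans (le_abs_self κ))
    rw [abs_of_pos hMX, abs_of_pos hL, le_div_iff₀ (by positivity)]
    linarith
  have hlog := log_mul_div_nonneg hn hp hh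
  have base := @sum_terms_eq_baseRate n p h a t
  rw [← hE] at base
  have e1 : 0 ≤ t / √(n * h) := by positivity
  have e2 : 0 ≤ 1 / √(n * h) := by positivity
  have e3 : 0 ≤ t ^ 2 * √(Real.log n) / (n * h) := by positivity
  have e4 : 0 ≤ a ^ 2 / h ^ 2 := by positivity
  have e5 : h ^ 2 ≤ E := by linarith
  have e8 := sq_nonneg h
  have e6 : a ≤ E := by linarith
  have e7 : a ^ 2 / h ^ 2 ≤ E := by linarith
  have t1 : Q * deviation n h t ≤ Q * E := by gcongr
  have t2 : |A.B2 * A.RK| * h ^ 2 ≤ |A.B2 * A.RK| * E := by gcongr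
  have t3 : a / h * (Q * deviation n h τ + c₂ * h) ≤
      Q * ((|A.L| / (2 * |A.MX|) + |κ|) * E) + c₂ * E := by
    have : a / h * (Q * deviation n h τ + c₂ * h) =
        Q * (a / h * deviation n h τ) + c₂ * a := by field_simp
    rw [this]
    gcongr
  have t4 : (2 * A.MX * (a / h)) ^ 2 * (Q * deviation n h t + c₃) ≤
      A.L ^ 2 * (Q * E) + (2 * A.MX) ^ 2 * c₃ * E := by
    have h1 : (2 * A.MX * (a / h)) ^ 2 * (Q * deviation n h t) ≤ A.L ^ 2 * (Q * E) := by
      gcongr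
    have h2 : (2 * A.MX * (a / h)) ^ 2 * c₃ = (2 * A.MX) ^ 2 * c₃ * (a ^ 2 / h ^ 2) := by
      ring
    have h3 : (2 * A.MX) ^ 2 * c₃ * (a ^ 2 / h ^ 2) ≤ (2 * A.MX) ^ 2 * c₃ * E := by gcongr
    linarith
  rw [hfac]
  linarith

section Linear

variable {A : Constants} {n p : ℕ} {P : Measure (ℝ × (Fin p → ℝ))} [IsProbabilityMeasure P]
  {β x : Fin p → ℝ} {f g : ℝ → ℝ} {Y : ℝ × (Fin p → ℝ) → ℝ} {s h a κ : ℝ} {K : ℝ → ℝ}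
  {Ω : Type*} [MeasurableSpace Ω] {μ : Measure Ω} [IsProbabilityMeasure μ]
  {ζ : Fin n → Ω → ℝ × (Fin p → ℝ)} {βhat : Ω → Fin p → ℝ}

/-- The deviation bound for a kernel average with estimated index and a general response. -/
theorem linear_average_bound (hn : 2 ≤ n) (hp : 1 ≤ p) (hh : 0 < h) (ha : 0 ≤ a)
    (haL : 2 * A.MX * (a / h) ≤ A.L) (hκ : a / h * √(Real.log p) ≤ κ)
    (hK : KernelConditions A K) (hY : ResponseConditions A P Y Prod.snd β f g)
    (hU : ResponseConditions A P (fun _ => 1) Prod.snd β f (fun _ => 1))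
    (hd : IsDensityOf P (fun z => β ⬝ᵥ z.2) f) (hb : ∀ᵐ z ∂P, ∀ j, |z.2 j| ≤ A.MX)
    (hYm : Measurable Y) (hYs : SquareExpBound P Y s) (hs : 0 < s)
    (hζ : ∀ i, Measurable (ζ i)) (hlaw : ∀ i, μ.map (ζ i) = P) (hind : iIndepFun ζ μ)
    (hx : ∀ j, |x j| ≤ A.MX) {t : ℝ} (ht : 0 ≤ t) :
    1 - (5 * Real.exp (-t ^ 2) + μ.real {ω | a < ∑ j, |βhat ω j - β j|}) ≤
      μ.real {ω | |lHat K h (fun i => Y (ζ i ω)) (fun i => (ζ i ω).2) (βhat ω) x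
        - g (β ⬝ᵥ x) * f (β ⬝ᵥ x)| ≤ A.rateFactor κ s * baseRate n p h a t} := by
  have hMX := covariate_bound_pos hd hb
  obtain ⟨φ, hφm, hφ0, hφM, hφi, hφC, hφL⟩ := hK.exists_measurable_lipschitz
  have hφw : IsKernelWeight A φ := by
    have e : ∀ u, |φ u| = φ u := fun u => abs_of_nonneg (hφ0 u)
    refine ⟨hφm, fun u => ?_, hφi, ?_⟩
    · rw [e]
      have := hφM u
      unfold Constants.kernelSup
      linarith [le_abs_self A.Mphi, abs_nonneg A.MdK, abs_nonneg A.MK]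
    · simp only [e]
      unfold Constants.kernelMass
      linarith [le_abs_self A.Cphi, abs_nonneg A.CdK, abs_nonneg A.CK]
  set w := β ⬝ᵥ x with hw
  set S := s * (A.kernelSup * A.diameter) with hS
  have hSp : 0 < S := by
    have h1 := A.kernelSup_pos
    have h2 := A.one_le_diameter
    positivity
  set Q := A.noiseFactor s with hQ
  have hQp : 0 < Q := A.noiseFactor_pos hs
  have hQle : 2 + 2 * A.varianceFactor + 7 * S ≤ Q := le_of_eq rfl
  have hVn := A.varianceFactor_nonneg
  have hKm := hK.isKernelWeight.measurable
  have hK'm := hK.isKernelWeight_deriv.measurable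
  -- the three families of summands
  set ξ₁ : ℝ × (Fin p → ℝ) → ℝ := fun z => Y z * K ((β ⬝ᵥ z.2 - w) / h) with hξ₁
  set ξ₂ : Fin p → ℝ × (Fin p → ℝ) → ℝ := fun j z =>
    Y z * deriv K ((β ⬝ᵥ z.2 - w) / h) * (z.2 j - x j) with hξ₂
  set ξ₃ : ℝ × (Fin p → ℝ) → ℝ := fun z => |Y z| * φ ((β ⬝ᵥ z.2 - w) / h) with hξ₃
  have m₁ : Measurable ξ₁ := by fun_prop
  have m₂ : ∀ j, Measurable (ξ₂ j) := fun j => by fun_prop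
  have m₃ : Measurable ξ₃ := by fun_prop
  -- Since `diameter` dominates both 1 and `|X_j - x_j|`, all three families share one sub-Gaussian
  -- scale and one variance factor.
  obtain ⟨s₁, v₁⟩ := hY.summand_bounds hd hYs hs hK.isKernelWeight hh w m₁
    (ae_of_all _ fun z => le_mul_of_one_le_left (abs_nonneg _) A.one_le_diameter)
  have hb₂ := fun j => hY.summand_bounds hd hYs hs hK.isKernelWeight_deriv hh w (m₂ j) (by
    filter_upwards [hb] with z hz
    rw [hξ₂, abs_mul, mul_comm]
    gcongr
    refine (abs_sub _ _).trans ?_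
    unfold Constants.diameter
    linarith [hz j, hx j, le_abs_self A.MX])
  obtain ⟨s₃, v₃⟩ := hY.summand_bounds hd hYs hs hφw hh w m₃ (ae_of_all _ fun z => by
    rw [hξ₃, abs_mul, abs_abs, ← abs_mul]
    exact le_mul_of_one_le_left (abs_nonneg _) A.one_le_diameter)
  have hlp := Real.log_natCast_nonneg p
  set τ := √(t ^ 2 + Real.log p) with hτ
  have p₁ := bernstein_average hζ hlaw hind s₁ m₁ hSp hVn hh v₁ hn hQle ht
  have p₂ := fun j => bernstein_average hζ hlaw hind (hb₂ j).1 (m₂ j) hSp hVn hh (hb₂ j).2 hn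
    hQle (Real.sqrt_nonneg (t ^ 2 + Real.log p))
  -- The remainder is only bounded from above, so one tail suffices; the total count is 2 + 2 + 1 =
  -- 5.
  have p₃ := bernstein_average_upper hζ hlaw hind s₃ m₃ hSp hVn hh v₃ hn hQle ht
  rw [← hτ] at p₂
  set N₁ : Set Ω := {ω | Q * deviation n h t <
    |1 / (n * h) * ∑ i, ξ₁ (ζ i ω) - (∫ z, ξ₁ z ∂P) / h|} with hN₁
  set N₂ : Fin p → Set Ω := fun j => {ω | Q * deviation n h τ <
    |1 / (n * h) * ∑ i, ξ₂ j (ζ i ω) - (∫ z, ξ₂ j z ∂P) / h|} with hN₂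
  set N₃ : Set Ω := {ω | Q * deviation n h t <
    1 / (n * h) * ∑ i, ξ₃ (ζ i ω) - (∫ z, ξ₃ z ∂P) / h} with hN₃
  set N₄ : Set Ω := {ω | a < ∑ j, |βhat ω j - β j|} with hN₄
  have hbad : μ.real ((N₁ ∪ ⋃ j, N₂ j) ∪ N₃ ∪ N₄) ≤ 5 * Real.exp (-t ^ 2) + μ.real N₄ := by
    -- The choice `τ² = t² + log p` exactly cancels the number of coordinates.
    have hexp : Real.exp (-τ ^ 2) * p = Real.exp (-t ^ 2) := by
      have hp0 : (0 : ℝ) < p := by positivity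
      rw [hτ, Real.sq_sqrt (by positivity)]
      nth_rw 2 [← Real.exp_log hp0]
      rw [← Real.exp_add]; ring_nf
    have h2 : μ.real (⋃ j, N₂ j) ≤ 2 * Real.exp (-t ^ 2) := by
      refine (measureReal_iUnion_fintype_le _).trans ?_
      refine (Finset.sum_le_sum fun j _ => p₂ j).trans (le_of_eq ?_)
      rw [Finset.sum_const, Finset.card_univ, Fintype.card_fin, nsmul_eq_mul, ← hexp]
      ring
    have u1 := measureReal_union_le (μ := μ) ((N₁ ∪ ⋃ j, N₂ j) ∪ N₃) N₄
    have u2 := measureReal_union_le (μ := μ) (N₁ ∪ ⋃ j, N₂ j) N₃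
    have u3 := measureReal_union_le (μ := μ) N₁ (⋃ j, N₂ j)
    linarith
  refine one_sub_le_measureReal ?_ hbad
  have g₁ : ∀ᵐ ω ∂μ, ∀ i, ∀ j, |(ζ i ω).2 j| ≤ A.MX := by
    rw [ae_all_iff]
    exact fun i => ae_of_ae_map (hζ i).aemeasurable (by rw [hlaw i]; exact hb)
  have g₂ : ∀ᵐ ω ∂μ, ∀ i, ∀ d, |d| ≤ A.L →
      |K ((β ⬝ᵥ (ζ i ω).2 - w) / h + d) - K ((β ⬝ᵥ (ζ i ω).2 - w) / h) -
      deriv K ((β ⬝ᵥ (ζ i ω).2 - w) / h) * d| ≤ φ ((β ⬝ᵥ (ζ i ω).2 - w) / h) * d ^ 2 := by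
    rw [ae_all_iff]
    intro i
    have := hd.ae_index hh w hφL
    rw [← hlaw i] at this
    exact ae_of_ae_map (hζ i).aemeasurable this
  filter_upwards [g₁, g₂] with ω hω1 hω2 hω
  simp only [Set.mem_union, Set.mem_iUnion, not_or, not_exists] at hω
  obtain ⟨⟨⟨n1, n2⟩, n3⟩, n4⟩ := hω
  simp only [hN₁, hN₂, hN₃, hN₄, Set.mem_ofPred_eq, not_lt] at n1 n2 n3 n4
  have mean₁ := hY.mean_kernel_le hd hK hh w
  have mean₂ := fun j => hY.mean_gradient_le hd hK hh w j (hx j)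
  have mean₃ := mean_abs_weight_le hY hU hd hYm hφw hφ0 hh w
  have hDτ : 0 ≤ deviation n h τ := by
    have := log_natCast_ge hn
    unfold deviation; positivity
  set c₂ := |A.CK| * (|A.B1star| + |A.MX| * |A.B2star|) with hc₂
  have hc₂0 : 0 ≤ c₂ := by positivity
  set c₃ := |A.B1| * A.kernelMass with hc₃
  have hc₃0 : 0 ≤ c₃ := mul_nonneg (abs_nonneg _) A.kernelMass_nonneg
  have main := abs_lHat_sub_le (z := fun i => Y (ζ i ω)) (xs := fun i => (ζ i ω).2)
    (l := g w * f w) (T₁ := Q * deviation n h t + |A.B2 * A.RK| * h ^ 2)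
    (T₂ := Q * deviation n h τ + c₂ * h) (T₃ := Q * deviation n h t + c₃) hh n4 hω1 hx
    hMX.le haL hφ0 hω2 ?_ ?_ (by positivity) ?_
  · refine main.trans ?_
    exact expansion_le_rateFactor_mul hn hp hh ha ht hMX hK.L_pos haL hκ hs
  · have : |(∫ z, ξ₁ z ∂P) / h - g w * f w| ≤ |A.B2 * A.RK| * h ^ 2 :=
      mean₁.trans (by gcongr; exact le_abs_self _)
    exact (abs_sub_le _ _ _).trans (add_le_add n1 this)
  · intro j
    have h1 : |(∫ z, ξ₂ j z ∂P) / h| ≤ c₂ * h := by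
      rw [abs_div, abs_of_pos hh, div_le_iff₀ hh]
      exact (mean₂ j).trans (le_of_eq (by ring))
    have h2 := abs_add_le (1 / (n * h) * ∑ i, ξ₂ j (ζ i ω) - (∫ z, ξ₂ j z ∂P) / h)
      ((∫ z, ξ₂ j z ∂P) / h)
    rw [sub_add_cancel] at h2
    exact h2.trans (add_le_add (n2 j) h1)
  · have h1 : (∫ z, ξ₃ z ∂P) / h ≤ c₃ := (div_le_iff₀ hh).2 mean₃
    have h2 : 1 / (n * h) * ∑ i, ξ₃ (ζ i ω) ≤ Q * deviation n h t + c₃ := by linarith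
    exact h2

end Linear

/-! ### From the Orlicz norm to exponential square moments. -/

section SubGaussian

variable {E : Type*} [MeasurableSpace E] {P : Measure E} [IsProbabilityMeasure P]

/-- The strict inequality `σ < s` provides an admissible `c < s` without asking whether the infimum
is attained. -/
lemma squareExpBound_of_psiTwoNorm_le {Y : E → ℝ} (hY : Measurable Y) {σ s : ℝ}
    (h : psiTwoNorm P Y ≤ ENNReal.ofReal σ) (hσ : σ < s) (hs : 0 < s) : SquareExpBound P Y s := by
  have h1 : psiTwoNorm P Y < ENNReal.ofReal s :=
    h.trans_lt ((ENNReal.ofReal_lt_ofReal_iff hs).2 hσ)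
  simp only [psiTwoNorm, iInf_lt_iff] at h1
  obtain ⟨c, hc, hle, hcs⟩ := h1
  have hcs' : c < s := (ENNReal.ofReal_lt_ofReal_iff hs).1 hcs
  set G : E → ℝ := fun z => Real.exp ((|Y z| / c) ^ 2) - 1 with hG
  have hGm : Measurable G := by fun_prop
  have hG0 : ∀ z, 0 ≤ G z := fun z => by
    have := Real.one_le_exp (sq_nonneg (|Y z| / c))
    simp only [hG]; linarith
  have hGi : Integrable G P := by
    refine ⟨hGm.aestronglyMeasurable, ?_⟩
    rw [hasFiniteIntegral_iff_ofReal (ae_of_all _ hG0)]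
    exact hle.trans_lt ENNReal.one_lt_top
  have hGle : ∫ z, G z ∂P ≤ 1 := by
    rw [integral_eq_lintegral_of_nonneg_ae (ae_of_all _ hG0) hGm.aestronglyMeasurable]
    exact ENNReal.toReal_mono ENNReal.one_ne_top hle
  have hb : ∀ z, Real.exp ((Y z / s) ^ 2) ≤ 1 + G z := fun z => by
    simp only [hG, add_sub_cancel]
    rw [Real.exp_le_exp, ← sq_abs (Y z / s), abs_div, abs_of_pos hs]
    gcongr
  have hi1 : Integrable (fun z => 1 + G z) P := (integrable_const 1).add hGi
  have hi : Integrable (fun z => Real.exp ((Y z / s) ^ 2)) P :=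
    hi1.mono' (by fun_prop) (ae_of_all _ fun z => by
      rw [Real.norm_eq_abs, abs_of_pos (Real.exp_pos _)]; exact hb z)
  refine ⟨hi, (integral_mono hi hi1 hb).trans ?_⟩
  rw [integral_add (integrable_const 1) hGi]
  simp only [integral_const, probReal_univ, smul_eq_mul, mul_one]
  linarith

lemma squareExpBound_one {s : ℝ} (hs : 2 ≤ s) : SquareExpBound P (fun _ => (1 : ℝ)) s := by
  refine ⟨integrable_const _, ?_⟩
  simp only [integral_const, probReal_univ, smul_eq_mul, one_mul]
  have h1 : (1 / s) ^ 2 ≤ Real.log 2 := by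
    have h2 : 1 / s ≤ 1 / 2 := one_div_le_one_div_of_le (by norm_num) hs
    have h3 : (1 / s) ^ 2 ≤ (1 / 2) ^ 2 := pow_le_pow_left₀ (by positivity) h2 2
    linarith [Real.log_two_gt_d9]
  calc Real.exp ((1 / s) ^ 2) ≤ Real.exp (Real.log 2) := Real.exp_le_exp.2 h1
    _ = 2 := Real.exp_log (by norm_num)

end SubGaussian

lemma fHat_eq_lHat_one (K : ℝ → ℝ) (h : ℝ) {n p : ℕ} (xs : Fin n → Fin p → ℝ) (b x : Fin p → ℝ) :
    fHat K h xs b x = lHat K h (fun _ => 1) xs b x := by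
  simp [fHat, lHat]

/-- The common constant in front of the three terms of the rate. -/
def Constants.linearFactor (A : Constants) (κ : ℝ) : ℝ := A.rateFactor κ (|A.sigmaZ| + 2)

lemma Constants.linearFactor_pos (A : Constants) (κ : ℝ) : 0 < A.linearFactor κ :=
  A.rateFactor_pos κ (by positivity)

/-! ### The linear and the ratio type estimators at fixed sample size. -/

section FixedSampleSize

variable {A : Constants} {n p : ℕ} {P : Measure (ℝ × (Fin p → ℝ))} {β x : Fin p → ℝ}
  {f m : ℝ → ℝ} {h a q κ : ℝ} {K : ℝ → ℝ} {Ω : Type*} [MeasurableSpace Ω] {μ : Measure Ω}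
  [IsProbabilityMeasure μ] {Z : Fin n → Ω → ℝ} {X : Fin n → Ω → Fin p → ℝ}
  {βhat : Ω → Fin p → ℝ}

/-- The deviation bounds for the two linear kernel averages. -/
theorem linear_bounds (hn : 2 ≤ n) (hp : 1 ≤ p) (hh : 0 < h) (ha : 0 ≤ a)
    (haL : 2 * A.MX * (a / h) ≤ A.L) (hκ : a / h * √(Real.log p) ≤ κ)
    (hK : KernelConditions A K) (hP : PopulationConditions A P β f m)
    (hS : SampleConditions μ P Z X β βhat a q) (hx : x ∈ (P.map Prod.snd).support)
    {t : ℝ} (ht : 0 ≤ t) :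
    1 - (5 * Real.exp (-t ^ 2) + q) ≤
      μ.real {ω | |lHat K h (fun i => Z i ω) (fun i => X i ω) (βhat ω) x
        - m (β ⬝ᵥ x) * f (β ⬝ᵥ x)| ≤ A.linearFactor κ * baseRate n p h a t} ∧
    1 - (5 * Real.exp (-t ^ 2) + q) ≤
      μ.real {ω | |fHat K h (fun i => X i ω) (βhat ω) x - f (β ⬝ᵥ x)| ≤
        A.linearFactor κ * baseRate n p h a t} := by
  have hζ : ∀ i, Measurable fun ω => (Z i ω, X i ω) := fun i =>
    (hS.measurable_Z i).prodMk (hS.measurable_X i)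
  have hPp : IsProbabilityMeasure P := by
    rw [← hS.law ⟨0, by omega⟩]
    exact Measure.isProbabilityMeasure_map (hζ _).aemeasurable
  have hxb := abs_le_of_mem_support hP.bounded hx
  -- This scale lies strictly above `sigmaZ` and is at least 2, where the constant response
  -- qualifies as well, so both estimators get the same constant.
  have hs : 0 < |A.sigmaZ| + 2 := by positivity
  have hsZ : SquareExpBound P Prod.fst (|A.sigmaZ| + 2) :=
    squareExpBound_of_psiTwoNorm_le measurable_fst hP.subGaussian
      (by linarith [le_abs_self A.sigmaZ]) hs
  have hs1 : SquareExpBound P (fun _ => (1 : ℝ)) (|A.sigmaZ| + 2) :=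
    squareExpBound_one (by linarith [abs_nonneg A.sigmaZ])
  have b1 := linear_average_bound (βhat := βhat) hn hp hh ha haL hκ hK hP.response
    hP.unit_response hP.density hP.bounded measurable_fst hsZ hs hζ hS.law hS.indep hxb ht
  have b2 := linear_average_bound (βhat := βhat) hn hp hh ha haL hκ hK hP.unit_response
    hP.unit_response hP.density hP.bounded measurable_const hs1 hs hζ hS.law hS.indep hxb ht
  have hq := hS.index_error
  simp only [one_mul] at b2
  simp only [fHat_eq_lHat_one]
  exact ⟨le_trans (by linarith) b1, le_trans (by linarith) b2⟩

/-- Write `l / fh - m = ((l - m f) - m (fh - f)) / fh`; the cruder bound `δf / 2` serves only to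
keep the denominator above `δf / 2`. -/
lemma ratio_bound {l fh m f ε δm δf : ℝ} (hl : |l - m * f| ≤ ε) (hf : |fh - f| ≤ ε)
    (hf' : |fh - f| ≤ δf / 2) (hδf : 0 < δf) (hm : |m| ≤ δm) (hfδ : δf ≤ f) :
    fh ≠ 0 ∧ |l / fh - m| ≤ 2 * (1 + δm) / δf * ε := by
  have hε : 0 ≤ ε := (abs_nonneg _).trans hl
  have hfh : δf / 2 ≤ fh := by linarith [(abs_le.1 hf').1]
  have hfh0 : 0 < fh := by linarith
  refine ⟨hfh0.ne', ?_⟩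
  have e : l / fh - m = ((l - m * f) - m * (fh - f)) / fh := by field_simp; ring
  rw [e, abs_div, abs_of_pos hfh0, div_le_iff₀ hfh0]
  have h1 : |(l - m * f) - m * (fh - f)| ≤ (1 + δm) * ε := by
    refine (abs_sub _ _).trans ?_
    rw [abs_mul]
    have : |m| * |fh - f| ≤ δm * ε :=
      mul_le_mul hm hf (abs_nonneg _) ((abs_nonneg m).trans hm)
    linarith
  refine h1.trans ?_
  have hδm : 0 ≤ δm := (abs_nonneg m).trans hm
  calc (1 + δm) * ε = 2 * (1 + δm) / δf * ε * (δf / 2) := by field_simp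
    _ ≤ _ := by gcongr

/-- The deviation bound for the ratio type estimator. -/
theorem ratio_bounds (hn : 2 ≤ n) (hp : 1 ≤ p) (hh : 0 < h) (ha : 0 ≤ a)
    (haL : 2 * A.MX * (a / h) ≤ A.L) (hκ : a / h * √(Real.log p) ≤ κ)
    (hK : KernelConditions A K) (hP : PopulationConditions A P β f m)
    (hS : SampleConditions μ P Z X β βhat a q) (hx : x ∈ (P.map Prod.snd).support)
    {δm δf : ℝ} (hδf : 0 < δf) (hm : |m (β ⬝ᵥ x)| ≤ δm) (hf : δf ≤ f (β ⬝ᵥ x))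
    {t t' : ℝ} (ht : 0 ≤ t) (ht' : 0 ≤ t')
    (hside : A.linearFactor κ * baseRate n p h a t' ≤ δf / 2) :
    1 - 18 * Real.exp (-t ^ 2) - 9 * Real.exp (-t' ^ 2) - 6 * q ≤
      μ.real {ω | fHat K h (fun i => X i ω) (βhat ω) x ≠ 0 ∧
        |mHat K h (fun i => Z i ω) (fun i => X i ω) (βhat ω) x - m (β ⬝ᵥ x)| ≤
          2 * (1 + δm) / δf * (A.linearFactor κ * baseRate n p h a t)} := by
  obtain ⟨b1, b2⟩ := linear_bounds hn hp hh ha haL hκ hK hP hS hx ht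
  obtain ⟨-, b3⟩ := linear_bounds hn hp hh ha haL hκ hK hP hS hx ht'
  have hq : 0 ≤ q := measureReal_nonneg.trans hS.index_error
  have hKc := hK.contDiff.continuous.measurable
  have hmX : ∀ i, Measurable (X i) := hS.measurable_X
  have hmZ := hS.measurable_Z
  have hmβ := hS.measurable_βhat
  have meas : ∀ z : Fin n → Ω → ℝ, (∀ i, Measurable (z i)) →
      Measurable fun ω => lHat K h (fun i => z i ω) (fun i => X i ω) (βhat ω) x := by
    intro z hz
    unfold lHat dotProduct
    fun_prop
  have measf : Measurable fun ω => fHat K h (fun i => X i ω) (βhat ω) x := by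
    simp only [fHat_eq_lHat_one]
    exact meas (fun _ _ => 1) fun i => measurable_const
  have measl := meas Z hmZ
  set S₁ := {ω | |lHat K h (fun i => Z i ω) (fun i => X i ω) (βhat ω) x
        - m (β ⬝ᵥ x) * f (β ⬝ᵥ x)| ≤ A.linearFactor κ * baseRate n p h a t}
  set S₂ := {ω | |fHat K h (fun i => X i ω) (βhat ω) x - f (β ⬝ᵥ x)| ≤
        A.linearFactor κ * baseRate n p h a t}
  set S₃ := {ω | |fHat K h (fun i => X i ω) (βhat ω) x - f (β ⬝ᵥ x)| ≤
        A.linearFactor κ * baseRate n p h a t'}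
  have m₁ : MeasurableSet S₁ := measurableSet_le (by fun_prop) measurable_const
  have m₂ : MeasurableSet S₂ := measurableSet_le (by fun_prop) measurable_const
  have m₃ : MeasurableSet S₃ := measurableSet_le (by fun_prop) measurable_const
  have c₁ := probReal_compl_eq_one_sub (μ := μ) m₁
  have c₂ := probReal_compl_eq_one_sub (μ := μ) m₂
  have c₃ := probReal_compl_eq_one_sub (μ := μ) m₃
  -- The three linear bounds cost 10, 5 and 3 in place of 18, 9 and 6. Measurability was needed to
  -- pass to complements.
  have hbad : μ.real (S₁ᶜ ∪ S₂ᶜ ∪ S₃ᶜ) ≤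
      18 * Real.exp (-t ^ 2) + 9 * Real.exp (-t' ^ 2) + 6 * q := by
    have u1 := measureReal_union_le (μ := μ) (S₁ᶜ ∪ S₂ᶜ) S₃ᶜ
    have u2 := measureReal_union_le (μ := μ) S₁ᶜ S₂ᶜ
    have e1 := Real.exp_pos (-t ^ 2)
    have e2 := Real.exp_pos (-t' ^ 2)
    linarith
  have main := one_sub_le_measureReal (μ := μ)
    (S := {ω | fHat K h (fun i => X i ω) (βhat ω) x ≠ 0 ∧
        |mHat K h (fun i => Z i ω) (fun i => X i ω) (βhat ω) x - m (β ⬝ᵥ x)| ≤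
          2 * (1 + δm) / δf * (A.linearFactor κ * baseRate n p h a t)})
    (ae_of_all _ fun ω hω => ?_) hbad
  · linarith
  · simp only [Set.mem_union, Set.mem_compl_iff, not_or, not_not] at hω
    exact ratio_bound hω.1.1 hω.1.2 (hω.2.trans hside) hδf hm hf

end FixedSampleSize

/-! ### The choice `t = c √(log (n p))`. -/

section LogarithmicChoice

variable {n p : ℕ} {h a c : ℝ}

lemma sqrt_log_mul_ge (hn : 2 ≤ n) (hp : 1 ≤ p) : 0.8 ≤ √(Real.log (n * p)) :=
  (sqrt_log_natCast_ge hn).trans (Real.sqrt_le_sqrt (log_natCast_le_log_mul hn hp))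

lemma baseRate_log_eq (hn : 2 ≤ n) (hp : 1 ≤ p) (hh : 0 < h) :
    baseRate n p h a (c * √(Real.log (n * p))) =
      (c * √(Real.log (n * p)) + 1) / √(n * h) +
      c * √(Real.log (n * p) / (n * h)) *
        (c * √(Real.log (n * p) * Real.log n / (n * h))) + bRate n p h a := by
  have hlog : 0 ≤ Real.log (n * p) := by
    linarith [log_natCast_le_log_mul hn hp, log_natCast_ge hn]
  have hN : 0 < n * h := by positivity
  have hsN : √(n * h) ^ 2 = n * h := Real.sq_sqrt hN.le
  rw [baseRate, Real.sqrt_div hlog, Real.sqrt_div (by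
    have := log_natCast_ge hn
    positivity), Real.sqrt_mul hlog]
  have e : ∀ y, y / (n * h) = y / √(n * h) ^ 2 := fun y => by rw [hsN]
  rw [e (_ * √(Real.log n))]
  ring

lemma sqrt_div_eq (hn : 2 ≤ n) (hp : 1 ≤ p) :
    √(Real.log (n * p) / (n * h)) = √(Real.log (n * p)) / √(n * h) := by
  rw [Real.sqrt_div]
  linarith [log_natCast_le_log_mul hn hp, log_natCast_ge hn]

/-- The summand 1 is absorbed because `√(log (n p)) ≥ 0.8`, at the price of `c + 1` and a factor 2.
-/
lemma baseRate_log_le (hn : 2 ≤ n) (hp : 1 ≤ p) (hh : 0 < h) (ha : 0 ≤ a) (hc : 0 ≤ c) :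
    baseRate n p h a (c * √(Real.log (n * p))) ≤
      2 * ((c + 1) * √(Real.log (n * p) / (n * h)) *
        (1 + c * √(Real.log (n * p) * Real.log n / (n * h))) + bRate n p h a) := by
  have hb := bRate_nonneg hn hp hh ha
  have hl := sqrt_log_mul_ge hn hp
  rw [baseRate_log_eq hn hp hh]
  have h1 : (c * √(Real.log (n * p)) + 1) / √(n * h) ≤
      2 * ((c + 1) * √(Real.log (n * p) / (n * h))) := by
    rw [sqrt_div_eq hn hp, ← mul_div_assoc, ← mul_div_assoc]
    gcongr
    nlinarith
  have h2 : 0 ≤ √(Real.log (n * p) / (n * h)) *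
      (c * √(Real.log (n * p) * Real.log n / (n * h))) := by positivity
  nlinarith [mul_nonneg hc h2]

lemma baseRate_log_le_of_one_le (hn : 2 ≤ n) (hp : 1 ≤ p) (hh : 0 < h) (ha : 0 ≤ a) (hc : 0 ≤ c)
    (h1 : 1 ≤ c * √(Real.log (n * p))) {κ : ℝ}
    (hκ : c * √(Real.log (n * p) * Real.log n / (n * h)) ≤ κ) :
    baseRate n p h a (c * √(Real.log (n * p))) ≤
      (2 + κ) * (c * √(Real.log (n * p) / (n * h)) + bRate n p h a) := by
  have hb := bRate_nonneg hn hp hh ha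
  have hκ0 : 0 ≤ κ := le_trans (by positivity) hκ
  rw [baseRate_log_eq hn hp hh]
  have h2 : (c * √(Real.log (n * p)) + 1) / √(n * h) ≤
      2 * (c * √(Real.log (n * p) / (n * h))) := by
    rw [sqrt_div_eq hn hp, ← mul_div_assoc, ← mul_div_assoc]
    gcongr
    linarith
  have h3 : 0 ≤ c * √(Real.log (n * p) / (n * h)) := by positivity
  nlinarith [mul_le_mul_of_nonneg_left hκ h3, mul_nonneg hκ0 hb]

lemma exp_neg_log_sq (hn : 2 ≤ n) (hp : 1 ≤ p) :
    Real.exp (-(c * √(Real.log (n * p))) ^ 2) = ((n : ℝ) * p) ^ (-c ^ 2) := by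
  have hlog : 0 ≤ Real.log (n * p) := by
    linarith [log_natCast_le_log_mul hn hp, log_natCast_ge hn]
  rw [Real.rpow_def_of_pos (by positivity), mul_pow, Real.sq_sqrt hlog]
  ring_nf

end LogarithmicChoice

/-! ### The side conditions hold for large `n`. -/

section Asymptotics

variable {A : Constants} {p : ℕ → ℕ} {h a q : ℕ → ℝ}

/-- As `log n ≥ 0.69`, twice `log (n p)` dominates both 1 and `√(log n)`, so `log (n p) / (n h) → 0`
controls the two stochastic terms. -/
lemma RateConditions.eventually_baseRate_le (hR : RateConditions A p h a q) {t C ε : ℝ}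
    (ht : 0 ≤ t) (hC : 0 < C) (hε : 0 < ε) :
    ∀ᶠ n in atTop, C * baseRate n (p n) (h n) (a n) t ≤ ε := by
  have hr := hR.tendsto_log
  have h1 : Tendsto (fun n => C * ((t + 1) * √(2 * (Real.log (n * p n) / (n * h n))) +
      t ^ 2 * (2 * (Real.log (n * p n) / (n * h n))) + bRate n (p n) (h n) (a n))) atTop
      (𝓝 (C * ((t + 1) * √(2 * 0) + t ^ 2 * (2 * 0) + 0))) :=
    ((((hr.const_mul 2).sqrt.const_mul (t + 1)).add
      ((hr.const_mul 2).const_mul (t ^ 2))).add hR.tendsto_b).const_mul C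
  have h2 : C * ((t + 1) * √(2 * 0) + t ^ 2 * (2 * 0) + 0) = 0 := by simp
  rw [h2] at h1
  filter_upwards [h1.eventually_le_const hε, eventually_ge_atTop 2] with n hle hn
  refine le_trans ?_ hle
  have hp := hR.p_pos n hn
  have hh := hR.h_pos n hn
  have hN : 0 < n * h n := by positivity
  have hlog := log_natCast_le_log_mul hn hp
  have hl := log_natCast_ge hn
  have hsl := sqrt_log_natCast_ge hn
  have hss : √(Real.log n) * √(Real.log n) = Real.log n := Real.mul_self_sqrt (by linarith)
  have b1 : 1 / √(n * h n) ≤ √(2 * (Real.log (n * p n) / (n * h n))) := by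
    rw [Real.le_sqrt (by positivity) (by
      have := log_mul_div_nonneg hn hp hh
      positivity), div_pow, Real.sq_sqrt hN.le, ← mul_div_assoc]
    gcongr
    linarith
  have b2 : √(Real.log n) / (n * h n) ≤ 2 * (Real.log (n * p n) / (n * h n)) := by
    rw [← mul_div_assoc]
    gcongr
    nlinarith
  unfold baseRate
  have e1 : (t + 1) / √(n * h n) = (t + 1) * (1 / √(n * h n)) := by ring
  have e2 : t ^ 2 * √(Real.log n) / (n * h n) = t ^ 2 * (√(Real.log n) / (n * h n)) := by ring
  rw [e1, e2]
  gcongr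

lemma RateConditions.eventually_baseRate_log_le (hR : RateConditions A p h a q) {c C ε : ℝ}
    (hlog : Tendsto (fun n : ℕ => Real.log (n * p n) * Real.log n / (n * h n)) atTop (𝓝 0))
    (hc : 0 ≤ c) (hC : 0 < C) (hε : 0 < ε) :
    ∀ᶠ n in atTop, C * baseRate n (p n) (h n) (a n) (c * √(Real.log (n * p n))) ≤ ε := by
  have h1 : Tendsto (fun n => C * (2 * ((c + 1) * √(Real.log (n * p n) / (n * h n)) *
      (1 + c * √(Real.log (n * p n) * Real.log n / (n * h n))) + bRate n (p n) (h n) (a n))))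
      atTop (𝓝 (C * (2 * ((c + 1) * √0 * (1 + c * √0) + 0)))) :=
    ((((hR.tendsto_log.sqrt.const_mul (c + 1)).mul
      ((hlog.sqrt.const_mul c).const_add 1)).add hR.tendsto_b).const_mul 2).const_mul C
  have h2 : C * (2 * ((c + 1) * √0 * (1 + c * √0) + 0)) = 0 := by simp
  rw [h2] at h1
  filter_upwards [h1.eventually_le_const hε, eventually_ge_atTop 2] with n hle hn
  refine le_trans ?_ hle
  gcongr
  exact baseRate_log_le hn (hR.p_pos n hn) (hR.h_pos n hn) (hR.a_nonneg n hn) hc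

end Asymptotics

end SingleIndexKS

end

/-! ### Assembly of the theorem. -/

theorem mainTheorem7 (A : SingleIndexKS.Constants) (κ : ℝ) :
    -- constants that depend only on those in the assumptions and on `κ`
    ∃ C₁ C₂ C₃ : ℝ, 0 < C₁ ∧ 0 < C₂ ∧ 0 < C₃ ∧
    ∀ δm δf : ℝ, 0 < δm → 0 < δf →
    -- the constant in `≲`, which may also depend on `δm` and `δf`
    ∃ D : ℝ, 0 < D ∧
    ∀ (K : ℝ → ℝ) (p : ℕ → ℕ) (h a q : ℕ → ℝ) (β : ∀ n, Fin (p n) → ℝ)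
      (P : ∀ n, Measure (ℝ × (Fin (p n) → ℝ))) (f m : ℕ → ℝ → ℝ)
      (Ω : ℕ → Type*) [∀ n, MeasurableSpace (Ω n)]
      (μ : ∀ n, Measure (Ω n)) [∀ n, IsProbabilityMeasure (μ n)]
      (Z : ∀ n, Fin n → Ω n → ℝ) (X : ∀ n, Fin n → Ω n → Fin (p n) → ℝ)
      (βhat : ∀ n, Ω n → Fin (p n) → ℝ),
      SingleIndexKS.KernelConditions A K →
      SingleIndexKS.RateConditions A p h a q →
      (∀ n, 2 ≤ n → SingleIndexKS.PopulationConditions A (P n) (β n) (f n) (m n)) →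
      (∀ n, 2 ≤ n →
        SingleIndexKS.SampleConditions (μ n) (P n) (Z n) (X n) (β n) (βhat n) (a n) (q n)) →
      -- for each `t`, the side condition on `t` holds for all large `n`
      (∀ t : ℝ, 0 ≤ t → ∀ᶠ n in atTop,
        SingleIndexKS.epsRate C₁ C₂ C₃ n (p n) (h n) (a n) t ≤ δf / 2) ∧
      -- so does the one on `t = c √(log (n p))`
      (Tendsto (fun n : ℕ => Real.log (n * p n) * Real.log n / (n * h n)) atTop (𝓝 0) →
        ∀ c : ℝ, 0 < c → ∀ᶠ n in atTop,
          SingleIndexKS.epsRate C₁ C₂ C₃ n (p n) (h n) (a n)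
            (c * √(Real.log (n * p n))) ≤ δf / 2) ∧
      ∀ n : ℕ, 2 ≤ n → a n / h n * √(Real.log (p n)) ≤ κ →
        ∀ x ∈ ((P n).map Prod.snd).support,
        -- the bounds for the two linear kernel averages, with the same constants
        (∀ t : ℝ, 0 ≤ t →
          1 - 9 * Real.exp (-t ^ 2) - 2 * q n ≤
            (μ n).real {ω |
              |SingleIndexKS.lHat K (h n) (fun i => Z n i ω) (fun i => X n i ω) (βhat n ω) x
                - m n (β n ⬝ᵥ x) * f n (β n ⬝ᵥ x)|
              ≤ SingleIndexKS.epsRate C₁ C₂ C₃ n (p n) (h n) (a n) t} ∧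
          1 - 9 * Real.exp (-t ^ 2) - 2 * q n ≤
            (μ n).real {ω |
              |SingleIndexKS.fHat K (h n) (fun i => X n i ω) (βhat n ω) x - f n (β n ⬝ᵥ x)|
              ≤ SingleIndexKS.epsRate C₁ C₂ C₃ n (p n) (h n) (a n) t}) ∧
        (|m n (β n ⬝ᵥ x)| ≤ δm → δf ≤ f n (β n ⬝ᵥ x) →
          -- the bound for the ratio type estimator
          (∀ t tstar : ℝ, 0 ≤ t → 0 ≤ tstar →
            SingleIndexKS.epsRate C₁ C₂ C₃ n (p n) (h n) (a n) tstar ≤ δf / 2 →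
            1 - 18 * Real.exp (-t ^ 2) - 9 * Real.exp (-tstar ^ 2) - 6 * q n ≤
              (μ n).real {ω |
                SingleIndexKS.fHat K (h n) (fun i => X n i ω) (βhat n ω) x ≠ 0 ∧
                |SingleIndexKS.mHat K (h n) (fun i => Z n i ω) (fun i => X n i ω) (βhat n ω) x
                  - m n (β n ⬝ᵥ x)|
                ≤ 2 * (1 + δm) / δf *
                  SingleIndexKS.epsRate C₁ C₂ C₃ n (p n) (h n) (a n) t}) ∧
          (∀ t : ℝ, 0 ≤ t →
            2 * (1 + δm) / δf * SingleIndexKS.epsRate C₁ C₂ C₃ n (p n) (h n) (a n) t ≤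
              D * ((t + 1) / √(n * h n) + t ^ 2 * √(Real.log n) / (n * h n)
                + SingleIndexKS.bRate n (p n) (h n) (a n))) ∧
          -- the choice `t = tstar = c √(log (n p))`
          (Tendsto (fun k : ℕ => Real.log (k * p k) * Real.log k / (k * h k)) atTop (𝓝 0) →
            ∀ c : ℝ, 0 < c →
            SingleIndexKS.epsRate C₁ C₂ C₃ n (p n) (h n) (a n)
              (c * √(Real.log (n * p n))) ≤ δf / 2 →
            1 - 27 * ((n : ℝ) * p n) ^ (-c ^ 2) - 6 * q n ≤
              (μ n).real {ω |
                SingleIndexKS.fHat K (h n) (fun i => X n i ω) (βhat n ω) x ≠ 0 ∧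
                |SingleIndexKS.mHat K (h n) (fun i => Z n i ω) (fun i => X n i ω) (βhat n ω) x
                  - m n (β n ⬝ᵥ x)|
                ≤ D * ((c + 1) * √(Real.log (n * p n) / (n * h n)) *
                    (1 + c * √(Real.log (n * p n) * Real.log n / (n * h n)))
                    + SingleIndexKS.bRate n (p n) (h n) (a n))} ∧
            (c * √(Real.log (n * p n) * Real.log n / (n * h n)) ≤ κ →
              1 - 27 * ((n : ℝ) * p n) ^ (-c ^ 2) - 6 * q n ≤
                (μ n).real {ω |
                  SingleIndexKS.fHat K (h n) (fun i => X n i ω) (βhat n ω) x ≠ 0 ∧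
                  |SingleIndexKS.mHat K (h n) (fun i => Z n i ω) (fun i => X n i ω)
                      (βhat n ω) x - m n (β n ⬝ᵥ x)|
                  ≤ D * (c * √(Real.log (n * p n) / (n * h n))
                    + SingleIndexKS.bRate n (p n) (h n) (a n))}))) := by
  have hC := A.linearFactor_pos κ
  set C := A.linearFactor κ with hCdef
  refine ⟨C, C, C, hC, hC, hC, fun δm δf hδm hδf => ?_⟩
  have hD₀ : 0 < 2 * (1 + δm) / δf := by positivity
  set D₀ := 2 * (1 + δm) / δf with hD₀def
  -- The factor `2 + |κ|` covers the 2 of `baseRate_log_le` and the `2 + κ` of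
  -- `baseRate_log_le_of_one_le`.
  refine ⟨D₀ * C * (2 + |κ|), by positivity, ?_⟩
  intro K p h a q β P f m Ω _ μ _ Z X βhat hK hR hP hS
  simp only [SingleIndexKS.epsRate_self]
  refine ⟨fun t ht => hR.eventually_baseRate_le ht hC (by positivity), fun hlog c hc =>
    hR.eventually_baseRate_log_le hlog hc.le hC (by positivity), ?_⟩
  intro n hn hκ x hx
  have hp := hR.p_pos n hn
  have hh := hR.h_pos n hn
  have ha := hR.a_nonneg n hn
  have haL := hR.a_small n hn
  have hq : 0 ≤ q n := (hR.q_mem n hn).1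
  refine ⟨fun t ht => ?_, fun hm hf => ⟨fun t t' ht ht' hside =>
    SingleIndexKS.ratio_bounds hn hp hh ha haL hκ hK (hP n hn) (hS n hn) hx hδf hm hf ht ht' hside,
    fun t ht => ?_, fun _ c hc hside => ?_⟩⟩
  · obtain ⟨b1, b2⟩ := SingleIndexKS.linear_bounds hn hp hh ha haL hκ hK (hP n hn) (hS n hn) hx ht
    have he := Real.exp_pos (-t ^ 2)
    exact ⟨le_trans (by linarith) b1, le_trans (by linarith) b2⟩
  · have hE := SingleIndexKS.baseRate_nonneg hn hp hh ha ht
    change D₀ * (C * SingleIndexKS.baseRate n (p n) (h n) (a n) t) ≤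
      D₀ * C * (2 + |κ|) * SingleIndexKS.baseRate n (p n) (h n) (a n) t
    have h1 : 0 ≤ D₀ * C * SingleIndexKS.baseRate n (p n) (h n) (a n) t := by positivity
    nlinarith [abs_nonneg κ, mul_nonneg h1 (abs_nonneg κ)]
  · have ht : 0 ≤ c * √(Real.log (n * p n)) := by positivity
    have hb := SingleIndexKS.bRate_nonneg hn hp hh ha
    have main := SingleIndexKS.ratio_bounds hn hp hh ha haL hκ hK (hP n hn) (hS n hn) hx hδf hm hf
      ht ht hside
    rw [SingleIndexKS.exp_neg_log_sq hn hp] at main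
    have transfer : ∀ r : ℝ, D₀ * (C * SingleIndexKS.baseRate n (p n) (h n) (a n)
        (c * √(Real.log (n * p n)))) ≤ r →
        1 - 27 * ((n : ℝ) * p n) ^ (-c ^ 2) - 6 * q n ≤
          (μ n).real {ω |
            SingleIndexKS.fHat K (h n) (fun i => X n i ω) (βhat n ω) x ≠ 0 ∧
            |SingleIndexKS.mHat K (h n) (fun i => Z n i ω) (fun i => X n i ω) (βhat n ω) x
              - m n (β n ⬝ᵥ x)| ≤ r} := by
      intro r hr
      refine le_trans (le_trans (le_of_eq (by ring)) main) (measureReal_mono ?_)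
      exact fun ω hω => ⟨hω.1, hω.2.trans hr⟩
    refine ⟨transfer _ ?_, fun hcκ => ?_⟩
    · have h1 := SingleIndexKS.baseRate_log_le (c := c) hn hp hh ha hc.le
      have h2 : 0 ≤ (c + 1) * √(Real.log (n * p n) / (n * h n)) *
          (1 + c * √(Real.log (n * p n) * Real.log n / (n * h n))) +
          SingleIndexKS.bRate n (p n) (h n) (a n) := by positivity
      refine le_trans (le_of_eq (mul_assoc _ _ _).symm) ?_
      rw [mul_assoc (D₀ * C)]
      refine mul_le_mul_of_nonneg_left (h1.trans ?_) (by positivity)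
      exact mul_le_mul_of_nonneg_right (by linarith [abs_nonneg κ]) h2
    -- If `c √(log (n p)) ≥ 1`, the 1 in `t + 1` is absorbed without enlarging `c`. Otherwise `27 (n
    -- p) ^ (-c²) ≥ 27 / e > 1` and the probability claim is void.
    · rcases le_or_gt 1 (c * √(Real.log (n * p n))) with h1 | h1
      · refine transfer _ ?_
        have h2 := SingleIndexKS.baseRate_log_le_of_one_le hn hp hh ha hc.le h1
          (hcκ.trans (le_abs_self κ))
        refine le_trans (le_of_eq (mul_assoc _ _ _).symm) ?_
        rw [mul_assoc (D₀ * C)]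
        exact mul_le_mul_of_nonneg_left h2 (by positivity)
      · refine le_trans ?_ measureReal_nonneg
        rw [← SingleIndexKS.exp_neg_log_sq hn hp]
        have h2 : Real.exp (-1) ≤ Real.exp (-(c * √(Real.log (n * p n))) ^ 2) :=
          Real.exp_le_exp.2 (by nlinarith)
        linarith [Real.exp_neg_one_gt_d9]
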